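/- Let $(\Phi u)(\xi)=(2\pi)^{-1/2}\int_{\mathbb R}u(x)e^{-ix\xi}\,dx$ be the Fourier transform. Let $\mathcal Z$ be the set of Schwartz functions on $\mathbb R$ which extend to entire functions satisfying, for some $r>0$ and all $n$, $|\varphi(z)|\le C_n(1+|z|)^{-n}e^{r|\operatorname{Im}z|}$, $z\in\mathbb C$; thus $\Phi$ maps $\mathcal Z$ onto $C_0^\infty(\mathbb R)$. Let $\mathcal Z'$ and $C_0^\infty(\mathbb R)'$ be the corresponding spaces of continuous antilinear functionals. A bounded operator $H$ on $L^2(\mathbb R_+)$ is the Hankel operator with (distributional) kernel $h$, where $\theta(x)=e^xh(e^x)$ belongs to $\mathcal Z'$, if $$(Hf_1,f_2)=\langle\theta,\Omega\rangle,\qquad \Omega(x)=\int_0^{e^x}\overline{f_1(s)}f_2(e^x-s)\,ds,$$ for all $f_1,f_2$ such that $e^{x/2}f_j(e^x)\in\mathcal Z$ (then $\Omega\in\mathcal Z$); for ordinary functions $h$ this is $(Hf)(t)=\int_0^\infty h(t+s)f(s)\,ds$. Its sign-function is $s=\sqrt{2\pi}\,\Phi^*b\in\mathcal Z'$, where $b(\xi)=(2\pi)^{-1/2}\Gamma(1-i\xi)^{-1}(\Phi\theta)(\xi)\in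 C_0^\infty(\mathbb R)'$. For a bounded self-adjoint operator $A$, let $N_-(A)$ be the total multiplicity of its strictly negative spectrum. Let $H_0$ be a bounded Hankel operator on $L^2(\mathbb R_+)$ whose sign-function $s_0$ is a bounded non-negative function. Let $V$ be the finite rank Hankel operator $(Vf)(t)=\int_0^\infty v(t+s)f(s)\,ds$ on $L^2(\mathbb R_+)$ with the real kernel $$v(t)=\sum_{m=1}^{M_0}P_m(t)e^{-\alpha_mt}+\sum_{m=M_0+1}^{M_0+M_1}\Big(P_m(t)e^{-\alpha_mt}+\overline{P_m(t)}e^{-\overline{\alpha_m}t}\Big),$$ where $M_0,M_1\ge0$, the numbers $\alpha_1,\dots,\alpha_{M_0+M_1}$ are distinct, $\operatorname{Re}\alpha_m>0$, $P_m$ is a non-zero polynomial of degree $K_m$, $\alpha_m$ and $P_m$ are real for $m\le M_0$, and $\operatorname{Im}\alpha_m>0$ for $m>M_0$. For $m\le M_0$ put ${\sf p}_m=P_m^{(K_m)}$ and $$\mathcal N_-^{(m)}=\begin{cases}(K_m+1)/2,&K_m\text{ odd},\\ K_m/2,&K_m\text{ even},\ {\sf p}_m>0,\\ K_m/2+1,&K_m\text{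 even},\ {\sf p}_m<0.\end{cases}$$ Then $V$ and $H_0+V$ are self-adjoint, $$N_-(H_0+V)=\sum_{m=1}^{M_0}\mathcal N_-^{(m)}+\sum_{m=M_0+1}^{M_0+M_1}K_m+M_1,$$ and $N_-(H_0+V)=N_-(V)$. In particular, $H_0+V\ge0$ if and only if $V\ge0$. -/

import Mathlib

open MeasureTheory
open scoped ContDiff Distributions SchwartzMap InnerProductSpace

noncomputable section

namespace HankelSign

/-- The Hilbert space `L²(ℝ₊)` of complex-valued functions. -/
abbrev L2Plus : Type := Lp ℂ 2 (volume.restrict (Set.Ioi (0 : ℝ)))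

/-! ### The space `𝒵` of test functions and its dual -/

/-- `F` is an entire function with `|F(z)| ≤ Cₙ (1+|z|)⁻ⁿ e^{r|Im z|}` for all `n`. -/
def HasTypeBound (F : ℂ → ℂ) (r : ℝ) : Prop :=
  Differentiable ℂ F ∧
    ∀ n : ℕ, ∃ C : ℝ, ∀ z : ℂ, ‖F z‖ ≤ C * ((1 + ‖z‖) ^ n)⁻¹ * Real.exp (r * |z.im|)

theorem HasTypeBound.mono {F : ℂ → ℂ} {r r' : ℝ} (h : HasTypeBound F r) (hr : r ≤ r') :
    HasTypeBound F r' := by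
  refine ⟨h.1, fun n => ?_⟩
  obtain ⟨C, hC⟩ := h.2 n
  refine ⟨|C|, fun z => (hC z).trans ?_⟩
  gcongr
  exact le_abs_self C

/-- The space `𝒵` of Schwartz functions on `ℝ` that extend to entire functions on `ℂ` satisfying
`|φ(z)| ≤ Cₙ (1+|z|)⁻ⁿ e^{r|Im z|}` for some `r = r(φ) > 0` and all `n`. -/
def ZSpace : Submodule ℂ 𝓢(ℝ, ℂ) where
  carrier := {φ | ∃ F : ℂ → ℂ, (∀ x : ℝ, F x = φ x) ∧ ∃ r > 0, HasTypeBound F r}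
  zero_mem' := ⟨0, fun _ => rfl, 1, one_pos, differentiable_const 0,
    fun _ => ⟨0, fun _ => by simp⟩⟩
  add_mem' := by
    rintro φ ψ ⟨F, hF, r, hr, hFr⟩ ⟨G, hG, q, hq, hGq⟩
    have hF' := hFr.mono (le_max_left r q)
    have hG' := hGq.mono (le_max_right r q)
    refine ⟨fun z => F z + G z, fun x => by simp [hF, hG], max r q, lt_max_of_lt_left hr,
      hF'.1.add hG'.1, fun n => ?_⟩
    obtain ⟨C, hC⟩ := hF'.2 n
    obtain ⟨D, hD⟩ := hG'.2 n
    refine ⟨C + D, fun z => (norm_add_le _ _).trans ((add_le_add (hC z) (hD z)).trans ?_)⟩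
    rw [add_mul, add_mul]
  smul_mem' := by
    rintro c φ ⟨F, hF, r, hr, hFr⟩
    refine ⟨fun z => c * F z, fun x => by simp [hF], r, hr, hFr.1.const_mul c, fun n => ?_⟩
    obtain ⟨C, hC⟩ := hFr.2 n
    refine ⟨‖c‖ * C, fun z => ?_⟩
    rw [norm_mul, mul_assoc, mul_assoc, ← mul_assoc C]
    exact mul_le_mul_of_nonneg_left (hC z) (norm_nonneg c)

/-- The dual `𝒵'`: continuous antilinear functionals on `𝒵`. As `𝒵` is the inductive limit over
`r` of the Fréchet spaces of functions of type `r`, continuity says that on each of these the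
functional is bounded by a multiple of one of the norms
`sup_z (1+|z|)ⁿ e^{-r|Im z|} |F(z)|`. -/
structure ZDual where
  /-- the underlying antilinear functional -/
  toFun : ZSpace →ₗ⋆[ℂ] ℂ
  bound : ∀ r > 0, ∃ n : ℕ, ∃ C : ℝ, ∀ (φ : ZSpace) (F : ℂ → ℂ),
    (∀ x : ℝ, F x = (φ : 𝓢(ℝ, ℂ)) x) → HasTypeBound F r →
    ∀ B : ℝ, (∀ z : ℂ, (1 + ‖z‖) ^ n * Real.exp (-(r * |z.im|)) * ‖F z‖ ≤ B) →
      ‖toFun φ‖ ≤ C * B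

/-- The space `C₀^∞(ℝ)` with its usual topology. -/
abbrev CcInfty : Type := 𝓓((⊤ : TopologicalSpace.Opens ℝ), ℂ)

/-- The dual `C₀^∞(ℝ)'`: continuous antilinear functionals on `C₀^∞(ℝ)`. -/
abbrev CcDual : Type := CcInfty →L⋆[ℂ] ℂ

/-! ### Fourier transform, `b`-function and sign-function -/

/-- The Fourier transform `(Φu)(ξ) = (2π)^{-1/2} ∫ u(x) e^{-ixξ} dx`. -/
def fourierPhi (u : ℝ → ℂ) (ξ : ℝ) : ℂ :=
  (((2 * Real.pi) ^ (-(1 / 2) : ℝ) : ℝ) : ℂ) *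
    ∫ x : ℝ, u x * Complex.exp (-(Complex.I * x * ξ))

/-- `a = Φθ` for `θ ∈ 𝒵'`, `a ∈ C₀^∞(ℝ)'`: one has `⟨a, Φφ⟩ = ⟨θ, φ⟩`. (`Φ` is a bijection of
`𝒵` onto `C₀^∞(ℝ)`, and so of `𝒵'` onto `C₀^∞(ℝ)'`.) -/
def IsFourierOf (θ : ZDual) (a : CcDual) : Prop :=
  ∀ (φ : ZSpace) (g : CcInfty), (∀ ξ : ℝ, g ξ = fourierPhi (φ : 𝓢(ℝ, ℂ)) ξ) → a g = θ.toFun φ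

/-- `b(ξ) = (2π)^{-1/2} a(ξ) Γ(1-iξ)⁻¹`, a distribution multiplied by a smooth function. -/
def IsBFunctionOf (a b : CcDual) : Prop :=
  ∀ g k : CcInfty,
    (∀ ξ : ℝ, k ξ = (starRingEnd ℂ) (Complex.Gamma (1 - Complex.I * ξ))⁻¹ * g ξ) →
      b g = (((2 * Real.pi) ^ (-(1 / 2) : ℝ) : ℝ) : ℂ) * a k

/-- `s ∈ 𝒵'` is the sign-function of the kernel `h` with `θ(x) = e^x h(e^x)`: it is
`s = √(2π) Φ* b` with the `b`-function `b = (2π)^{-1/2} Γ(1-iξ)⁻¹ a` and `a = Φθ`. -/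
def IsSignFunctionOf (θ s : ZDual) : Prop :=
  ∃ a b : CcDual, IsFourierOf θ a ∧ IsBFunctionOf a b ∧
    IsFourierOf s (((Real.sqrt (2 * Real.pi) : ℝ) : ℂ) • b)

/-- The distribution `s ∈ 𝒵'` is a bounded positive function:
`⟨s, u⟩ = ∫ s₀(x) conj(u(x)) dx` with `0 ≤ s₀ ∈ L^∞(ℝ)`. -/
def IsBoundedPositive (s : ZDual) : Prop :=
  ∃ s₀ : ℝ → ℝ, AEMeasurable s₀ ∧ (∀ᵐ x, 0 ≤ s₀ x) ∧ (∃ C : ℝ, ∀ᵐ x, s₀ x ≤ C) ∧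
    ∀ u : ZSpace, s.toFun u = ∫ x : ℝ, (s₀ x : ℂ) * (starRingEnd ℂ) ((u : 𝓢(ℝ, ℂ)) x)

/-! ### Hankel operators -/

/-- `f(t) = t^{-1/2} φ(ln t)`, the inverse of `(Uf)(x) = e^{x/2} f(e^x)`. -/
def Uinv (φ : ℝ → ℂ) (t : ℝ) : ℂ := ((t ^ (-(1 / 2) : ℝ) : ℝ) : ℂ) * φ (Real.log t)

/-- The Laplace convolution `(f̄₁ ⋆ f₂)(t) = ∫₀ᵗ conj(f₁(s)) f₂(t-s) ds`. -/
def laplaceConv (f₁ f₂ : ℝ → ℂ) (t : ℝ) : ℂ :=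
  ∫ s in (0 : ℝ)..t, (starRingEnd ℂ) (f₁ s) * f₂ (t - s)

/-- The bounded operator `H` on `L²(ℝ₊)` is the Hankel operator with the (distributional) kernel
`h` given by `θ(x) = e^x h(e^x)`, `θ ∈ 𝒵'`: for all `f₁, f₂` with `U f₁, U f₂ ∈ 𝒵`,
`(H f₁, f₂) = ⟨h, f̄₁ ⋆ f₂⟩ = ⟨θ, Ω⟩` where `Ω(x) = (f̄₁ ⋆ f₂)(e^x)` (this is a function in `𝒵`).
The inner product `(·,·)` is linear in its first argument. -/
def IsHankelOperator (H : L2Plus →L[ℂ] L2Plus) (θ : ZDual) : Prop :=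
  ∀ (φ₁ φ₂ : ZSpace) (f₁ f₂ : L2Plus),
    f₁ =ᵐ[volume.restrict (Set.Ioi (0 : ℝ))] Uinv (φ₁ : 𝓢(ℝ, ℂ)) →
    f₂ =ᵐ[volume.restrict (Set.Ioi (0 : ℝ))] Uinv (φ₂ : 𝓢(ℝ, ℂ)) →
    ∀ Ω : ZSpace,
      (∀ x : ℝ, (Ω : 𝓢(ℝ, ℂ)) x =
        laplaceConv (Uinv (φ₁ : 𝓢(ℝ, ℂ))) (Uinv (φ₂ : 𝓢(ℝ, ℂ))) (Real.exp x)) →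
      ⟪f₂, H f₁⟫_ℂ = θ.toFun Ω

/-- `V` is the integral operator `(Vf)(t) = ∫₀^∞ v(t+s) f(s) ds` on `L²(ℝ₊)`. -/
def IsHankelIntegralOperator (V : L2Plus →L[ℂ] L2Plus) (v : ℝ → ℂ) : Prop :=
  ∀ f : L2Plus, ∀ᵐ t ∂(volume.restrict (Set.Ioi (0 : ℝ))),
    V f t = ∫ s in Set.Ioi (0 : ℝ), v (t + s) * f s

/-- The data of the kernel of a self-adjoint finite rank Hankel operator: `M₀` real exponents with
non-zero real polynomials, and `M₁` exponents in the open upper half-plane with non-zero complex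
polynomials, each standing for itself and its complex conjugate. All exponents are distinct and
have positive real parts. -/
structure FiniteRankKernel where
  M₀ : ℕ
  M₁ : ℕ
  α : Fin M₀ → ℝ
  P : Fin M₀ → Polynomial ℝ
  γ : Fin M₁ → ℂ
  Q : Fin M₁ → Polynomial ℂ
  α_pos : ∀ m, 0 < α m
  α_inj : Function.Injective α
  P_ne : ∀ m, P m ≠ 0
  γ_re : ∀ m, 0 < (γ m).re
  γ_im : ∀ m, 0 < (γ m).im
  γ_inj : Function.Injective γ
  Q_ne : ∀ m, Q m ≠ 0

/-- The kernel `v(t) = ∑ P_m(t) e^{-α_m t}`, the sum over the real exponents and over the pairs of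
complex conjugate ones. -/
def FiniteRankKernel.kernel (k : FiniteRankKernel) (t : ℝ) : ℂ :=
  (∑ m, (((k.P m).eval t : ℝ) : ℂ) * Complex.exp (-(k.α m * t))) +
    ∑ m, ((k.Q m).eval (t : ℂ) * Complex.exp (-(k.γ m * t)) +
      (starRingEnd ℂ) ((k.Q m).eval (t : ℂ)) *
        Complex.exp (-((starRingEnd ℂ) (k.γ m) * t)))

/-- The number `𝒩₋` of a non-zero real polynomial `P` of degree `K`, with `p = P^{(K)}`:
`(K+1)/2` if `K` is odd, `K/2` if `K` is even and `p > 0`, `K/2 + 1` if `K` is even and `p < 0`. -/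
def negNumber (P : Polynomial ℝ) : ℕ :=
  if Odd P.natDegree then (P.natDegree + 1) / 2
  else if 0 < ((P.natDegree.factorial : ℕ) : ℝ) * P.leadingCoeff then P.natDegree / 2
  else P.natDegree / 2 + 1

/-- `∑_{m=1}^{M₀} 𝒩₋^{(m)} + ∑_{m=M₀+1}^{M₀+M₁} K_m + M₁`. -/
def FiniteRankKernel.totalNeg (k : FiniteRankKernel) : ℕ :=
  (∑ m, negNumber (k.P m)) + (∑ m, (k.Q m).natDegree) + k.M₁

/-- The total multiplicity `N₋(A) ∈ {0, 1, …, ∞}` of the strictly negative spectrum of a bounded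
self-adjoint operator `A`, i.e. the dimension of its spectral subspace for `(-∞, 0)`. The range of
the negative part `A⁻ = max(-A, 0)` (functional calculus) is dense in that subspace. -/
def Nminus {E : Type*} [NormedAddCommGroup E] [InnerProductSpace ℂ E] [CompleteSpace E]
    (A : E →L[ℂ] E) : ℕ∞ :=
  Cardinal.toENat (Module.rank ℂ (LinearMap.range ((A⁻ : E →L[ℂ] E) : E →ₗ[ℂ] E)))

end HankelSign

end

namespace HankelSign

/-! ### The negative index of a self-adjoint operator -/

/-! In the variable `x = ln t` the Laplace transform `L` with kernel `e^{-ts}` is, up to the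
reflection `x ↦ -x`, the Fourier multiplier `Γ(1/2 + iξ)` (`laplaceFun_Uinv_invPhi`). Writing `Ω`
for test functions through the Beta integral produces the same multiplier together with `Γ(1 +
iξ)⁻¹`, and passing from `θ` to the sign-function removes the latter (`inner_test_eq`). Hence the
form of `H₀` is the integral of `s₀` against a density whose total integral is `‖L f‖²`, and `0 ≤
(H₀ f, f) ≤ C ‖L f‖²` for all `f` by density (`exists_form_bound`).

The form of `V` is a sum of blocks pairing an exponent with its conjugate. Each block is triangular
with respect to the antidiagonal, since the coefficient of `sᵃ tᵇ` in `P(s + t)` vanishes for `a + b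
> deg P`. Killing the first few moments therefore leaves a form of known sign. This bounds `N₋(V)`
and `N₋(-V)` by numbers whose sum is the rank of `V`, so both bounds are sharp (`Nminus_eq`). As `H₀
≥ 0`, the first bound holds for `H₀ + V` too (`Nminus_add_le`).

For the reverse inequality let `F` be the finite dimensional span of the exponential monomials,
which contains the range of `V`. The range of `L` meets `F` only in zero (`eq_zero_of_laplace_mem`):
`L` is injective and turns multiplication by `e^{-s}` into the shift `t ↦ t + 1`, which preserves
`F`; so the preimage of `F` is a finite dimensional space invariant under multiplication by
`e^{-s}`, an operator without eigenvectors. Consequently the negative subspace of `V` can be altered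
by vectors of `Fᗮ`, invisible to `V`, so that `L` becomes arbitrarily small on it. The form of `H₀`
is then negligible and `H₀ + V` stays negative there (`Nminus_le_Nminus_add`). -/

/-- Compactness of the unit sphere of `W` makes strict negativity uniform; if the sphere is empty,
`W = 0` and any constant serves. -/
theorem exists_forall_re_inner_le {E : Type*} [NormedAddCommGroup E] [InnerProductSpace ℂ E]
    {A : E →L[ℂ] E} (W : Submodule ℂ E) [FiniteDimensional ℂ W]
    (h : ∀ f ∈ W, f ≠ 0 → (⟪f, A f⟫_ℂ).re < 0) :
    ∃ c > 0, ∀ f ∈ W, (⟪f, A f⟫_ℂ).re ≤ -(c * ‖f‖ ^ 2) := by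
  by_cases hW : (Metric.sphere (0 : W) 1).Nonempty
  · have : ProperSpace W := FiniteDimensional.proper ℂ W
    have hcont : Continuous fun f : W => (⟪(f : E), A f⟫_ℂ).re := by fun_prop
    obtain ⟨w, hw, hmax⟩ := (isCompact_sphere (0 : W) 1).exists_isMaxOn hW hcont.continuousOn
    have hw1 : ‖w‖ = 1 := by simpa using hw
    have hw0 : (w : E) ≠ 0 := by
      intro h0
      have : w = 0 := by exact_mod_cast h0
      simp [this] at hw1
    refine ⟨-(⟪(w : E), A w⟫_ℂ).re, neg_pos.2 (h w w.2 hw0), fun f hf => ?_⟩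
    by_cases hf0 : f = 0
    · simp [hf0]
    have hn : ‖f‖ ≠ 0 := norm_ne_zero_iff.2 hf0
    let u : W := ((‖f‖⁻¹ : ℝ) : ℂ) • ⟨f, hf⟩
    have hu : u ∈ Metric.sphere (0 : W) 1 := by
      simp [u, norm_smul, hn]
    have h1 := hmax hu
    have h2 : (⟪(u : E), A u⟫_ℂ).re = ‖f‖⁻¹ ^ 2 * (⟪f, A f⟫_ℂ).re := by
      simp only [u, Submodule.coe_smul, map_smul, inner_smul_left, inner_smul_right,
        Complex.conj_ofReal, Complex.re_ofReal_mul]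
      ring
    simp only [Set.mem_ofPred_eq] at h1
    rw [h2, inv_pow, inv_mul_le_iff₀ (by positivity)] at h1
    linarith
  · refine ⟨1, one_pos, fun f hf => ?_⟩
    have hf0 : f = 0 := by
      by_contra hf0
      have hn : ‖f‖ ≠ 0 := norm_ne_zero_iff.2 hf0
      exact hW ⟨((‖f‖⁻¹ : ℝ) : ℂ) • ⟨f, hf⟩, by simp [norm_smul, hn]⟩
    simp [hf0]

section NegativeIndex

variable {E : Type*} [NormedAddCommGroup E] [InnerProductSpace ℂ E] [CompleteSpace E]

theorem re_inner_eq_posPart_sub_negPart {A : E →L[ℂ] E} (hA : IsSelfAdjoint A) (f : E) :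
    (⟪f, A f⟫_ℂ).re = (⟪f, A⁺ f⟫_ℂ).re - (⟪f, A⁻ f⟫_ℂ).re := by
  conv_lhs => rw [← CFC.posPart_sub_negPart A hA]
  simp

theorem posPart_isPositive (A : E →L[ℂ] E) : (A⁺).IsPositive :=
  (ContinuousLinearMap.nonneg_iff_isPositive _).1 (CFC.posPart_nonneg A)

theorem negPart_isPositive (A : E →L[ℂ] E) : (A⁻).IsPositive :=
  (ContinuousLinearMap.nonneg_iff_isPositive _).1 (CFC.negPart_nonneg A)

/-- Writing `B = S* S` turns the form into `‖S f‖²`. -/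
theorem apply_eq_zero_of_isPositive {B : E →L[ℂ] E} (hB : B.IsPositive) {f : E}
    (h : (⟪f, B f⟫_ℂ).re = 0) : B f = 0 := by
  obtain ⟨S, rfl⟩ := CStarAlgebra.nonneg_iff_eq_star_mul_self.1
    ((ContinuousLinearMap.nonneg_iff_isPositive _).2 hB)
  have h1 : ⟪f, (star S * S) f⟫_ℂ = ⟪S f, S f⟫_ℂ :=
    ContinuousLinearMap.adjoint_inner_right S f (S f)
  rw [h1] at h
  have h2 : S f = 0 := by
    rw [← inner_self_eq_zero (𝕜 := ℂ)]
    refine Complex.ext h ?_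
    exact inner_self_im (𝕜 := ℂ) (S f)
  rw [mul_apply_eq_comp, h2, map_zero]

/-- Since `A⁺ A⁻ = 0`, only `-A⁻` contributes on this range. If the form vanished at `A⁻ y`, then
`A⁻ A⁻ y = 0` and `‖A⁻ y‖² = ⟪y, A⁻ A⁻ y⟫ = 0`. -/
theorem re_inner_neg_of_mem_range_negPart {A : E →L[ℂ] E} (hA : IsSelfAdjoint A) {f : E}
    (hf : f ∈ LinearMap.range ((A⁻ : E →L[ℂ] E) : E →ₗ[ℂ] E)) (h0 : f ≠ 0) :
    (⟪f, A f⟫_ℂ).re < 0 := by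
  obtain ⟨y, rfl⟩ := hf
  simp only [ContinuousLinearMap.coe_coe] at h0 ⊢
  have hp : A⁺ (A⁻ y) = 0 := by
    have := CFC.posPart_mul_negPart A
    exact DFunLike.congr_fun this y
  rw [re_inner_eq_posPart_sub_negPart hA, hp, inner_zero_right, Complex.zero_re, zero_sub,
    neg_lt_zero]
  have hB := negPart_isPositive A
  refine lt_of_le_of_ne (hB.re_inner_nonneg_right _) fun h => h0 ?_
  have h2 : A⁻ (A⁻ y) = 0 := apply_eq_zero_of_isPositive hB h.symm
  have h3 : ⟪A⁻ y, A⁻ y⟫_ℂ = 0 := by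
    rw [hB.isSymmetric.apply_clm, h2, inner_zero_right]
  exact inner_self_eq_zero.1 h3

/-- Glazman's argument: the range of `A⁻`, where the form is negative, meets the common kernel of
the functionals trivially and so embeds in `ι → ℂ`. -/
theorem Nminus_le_card {A : E →L[ℂ] E} (hA : IsSelfAdjoint A) {ι : Type*} [Fintype ι]
    (x : ι → E) (h : ∀ f, (∀ i, ⟪x i, f⟫_ℂ = 0) → 0 ≤ (⟪f, A f⟫_ℂ).re) :
    Nminus A ≤ Fintype.card ι := by
  let R := LinearMap.range ((A⁻ : E →L[ℂ] E) : E →ₗ[ℂ] E)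
  let J : E →ₗ[ℂ] (ι → ℂ) := LinearMap.pi fun i => (innerSL ℂ (x i) : E →ₗ[ℂ] ℂ)
  have hinj : Function.Injective (J ∘ₗ R.subtype) := by
    rw [← LinearMap.ker_eq_bot, LinearMap.ker_eq_bot']
    intro f hf
    by_contra h0
    have h1 := re_inner_neg_of_mem_range_negPart hA f.2 (by simpa using h0)
    have h2 := h f fun i => by simpa [J] using congrFun hf i
    linarith
  have : FiniteDimensional ℂ R := FiniteDimensional.of_injective _ hinj
  have hr := LinearMap.finrank_le_finrank_of_injective hinj
  rw [Module.finrank_fintype_fun_eq_card] at hr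
  change Cardinal.toENat (Module.rank ℂ R) ≤ _
  rw [← Module.finrank_eq_rank, Cardinal.toENat_nat]
  exact_mod_cast hr

/-- On the kernel of `A⁻` the form equals that of `A⁺`, so `A⁻` is injective on `W`. -/
theorem finrank_le_Nminus {A : E →L[ℂ] E} (hA : IsSelfAdjoint A) (W : Submodule ℂ E)
    [FiniteDimensional ℂ W] (h : ∀ f ∈ W, f ≠ 0 → (⟪f, A f⟫_ℂ).re < 0) :
    (Module.finrank ℂ W : ℕ∞) ≤ Nminus A := by
  let B : E →ₗ[ℂ] E := ((A⁻ : E →L[ℂ] E) : E →ₗ[ℂ] E)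
  let J : W →ₗ[ℂ] LinearMap.range B := B.rangeRestrict ∘ₗ W.subtype
  have hinj : Function.Injective J := by
    rw [← LinearMap.ker_eq_bot, LinearMap.ker_eq_bot']
    intro f hf
    by_contra h0
    have h1 := h f f.2 (by simpa using h0)
    have h2 : A⁻ (f : E) = 0 := congrArg Subtype.val hf
    rw [re_inner_eq_posPart_sub_negPart hA, h2, inner_zero_right, Complex.zero_re, sub_zero] at h1
    have := (posPart_isPositive A).re_inner_nonneg_right (f : E)
    exact absurd h1 (not_lt.2 this)
  have hr := LinearMap.rank_le_of_injective _ hinj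
  rw [← Module.finrank_eq_rank] at hr
  have h2 := Cardinal.toENat.monotone' hr
  exact (Cardinal.toENat_nat _).symm.le.trans h2

theorem rank_le_Nminus_add {A : E →L[ℂ] E} (hA : IsSelfAdjoint A) :
    Cardinal.toENat (Module.rank ℂ (LinearMap.range (A : E →ₗ[ℂ] E))) ≤
      Nminus A + Nminus (-A) := by
  have hle : LinearMap.range (A : E →ₗ[ℂ] E) ≤
      LinearMap.range ((A⁻ : E →L[ℂ] E) : E →ₗ[ℂ] E) ⊔
        LinearMap.range (((-A)⁻ : E →L[ℂ] E) : E →ₗ[ℂ] E) := by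
    rintro _ ⟨y, rfl⟩
    have h : A y = A⁺ y - A⁻ y := by
      conv_lhs => rw [← CFC.posPart_sub_negPart A hA]
      rfl
    rw [CFC.negPart_neg, ContinuousLinearMap.coe_coe, h]
    exact Submodule.sub_mem _ (Submodule.mem_sup_right ⟨y, rfl⟩)
      (Submodule.mem_sup_left ⟨y, rfl⟩)
  have h1 := (Submodule.rank_mono hle).trans (Submodule.rank_add_le_rank_add_rank _ _)
  refine (Cardinal.toENat.monotone' h1).trans (le_of_eq ?_)
  exact map_add Cardinal.toENat _ _

theorem isPositive_iff_Nminus_eq_zero {A : E →L[ℂ] E} (hA : IsSelfAdjoint A) :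
    A.IsPositive ↔ Nminus A = 0 := by
  rw [← ContinuousLinearMap.nonneg_iff_isPositive, ← CFC.negPart_eq_zero_iff A hA, Nminus]
  rw [Cardinal.toENat_eq_zero, Submodule.rank_eq_zero, LinearMap.range_eq_bot]
  exact ⟨fun h => by rw [h]; rfl, fun h => ContinuousLinearMap.coe_injective h⟩

/-- If no non-zero vector of the range of `T†` lies in the finite dimensional space `F`, then the
orthogonal projection of `f` to `F` may be prescribed while keeping `T f` small. -/
theorem exists_sub_mem_orthogonal_norm_lt {G : Type*} [NormedAddCommGroup G]
    [InnerProductSpace ℂ G] [CompleteSpace G] (T : E →L[ℂ] G) (F : Submodule ℂ E)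
    [FiniteDimensional ℂ F]
    (hF : ∀ g, ContinuousLinearMap.adjoint T g ∈ F → ContinuousLinearMap.adjoint T g = 0)
    (e : E) {δ : ℝ} (hδ : 0 < δ) : ∃ k ∈ Fᗮ, ‖T (e - k)‖ < δ := by
  let K : Submodule ℂ G := (Fᗮ.map (T : E →ₗ[ℂ] G)).topologicalClosure
  have : CompleteSpace K := (Submodule.isClosed_topologicalClosure _).completeSpace_coe
  have hg : ∀ k ∈ Fᗮ, ⟪T e - K.starProjection (T e), T k⟫_ℂ = 0 := fun k hk =>
    Submodule.inner_left_of_mem_orthogonal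
      (Submodule.le_topologicalClosure _ (Submodule.mem_map_of_mem hk))
      (K.sub_starProjection_mem_orthogonal (T e))
  -- The residual `g` is orthogonal to `T Fᗮ`, so `T† g ∈ Fᗮᗮ = F` and the hypothesis gives `T† g =
  -- 0`. Then `g ⊥ T e` as well, which forces `g = 0` and puts `T e` in the closure of `T Fᗮ`.
  set g := T e - K.starProjection (T e) with hgdef
  have h0 : ContinuousLinearMap.adjoint T g = 0 := by
    refine hF g ?_
    rw [← F.orthogonal_orthogonal, Submodule.mem_orthogonal']
    intro k hk
    rw [ContinuousLinearMap.adjoint_inner_left]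
    exact hg k hk
  have h1 : ⟪g, T e⟫_ℂ = 0 := by
    rw [← ContinuousLinearMap.adjoint_inner_left, h0, inner_zero_left]
  have h2 : ⟪g, K.starProjection (T e)⟫_ℂ = 0 :=
    Submodule.inner_left_of_mem_orthogonal (K.starProjection_apply_mem _)
      (K.sub_starProjection_mem_orthogonal (T e))
  have h3 : g = 0 := by
    rw [← inner_self_eq_zero (𝕜 := ℂ)]
    nth_rewrite 2 [hgdef]
    rw [inner_sub_right, h1, h2, sub_zero]
  have h4 : T e ∈ K := by
    rw [sub_eq_zero.1 (hgdef.symm.trans h3)]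
    exact K.starProjection_apply_mem _
  obtain ⟨_, ⟨k, hk, rfl⟩, hlt⟩ := Metric.mem_closure_iff.1 h4 δ hδ
  exact ⟨k, hk, by simpa [dist_eq_norm] using hlt⟩

/-- `V` vanishes on `Fᗮ`, so moving the negative subspace of `V` by vectors of `Fᗮ` leaves the form
of `V` unchanged, while the move can be chosen to make `T`, and with it the form of `A`, small. -/
theorem Nminus_le_Nminus_add {G : Type*} [NormedAddCommGroup G]
    [InnerProductSpace ℂ G] [CompleteSpace G] {A V : E →L[ℂ] E} (hA : IsSelfAdjoint A)
    (hV : IsSelfAdjoint V) (T : E →L[ℂ] G) {C : ℝ}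
    (hAT : ∀ f, (⟪f, A f⟫_ℂ).re ≤ C * ‖T f‖ ^ 2) (F : Submodule ℂ E) [FiniteDimensional ℂ F]
    (hVF : ∀ f, V f ∈ F)
    (hF : ∀ g, ContinuousLinearMap.adjoint T g ∈ F → ContinuousLinearMap.adjoint T g = 0) :
    Nminus V ≤ Nminus (A + V) := by
  let W := LinearMap.range ((V⁻ : E →L[ℂ] E) : E →ₗ[ℂ] E)
  have hVk : ∀ k ∈ Fᗮ, V k = 0 := fun k hk => by
    rw [← inner_self_eq_zero (𝕜 := ℂ), hV.isSymmetric.apply_clm]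
    exact Submodule.inner_left_of_mem_orthogonal (hVF _) hk
  have hW : ∀ f ∈ W, f ≠ 0 → (⟪f, V f⟫_ℂ).re < 0 := fun f hf h0 =>
    re_inner_neg_of_mem_range_negPart hV hf h0
  have : FiniteDimensional ℂ W := by
    let J : W →ₗ[ℂ] F := ((V : E →ₗ[ℂ] E).codRestrict F hVF) ∘ₗ W.subtype
    refine FiniteDimensional.of_injective J ?_
    rw [← LinearMap.ker_eq_bot, LinearMap.ker_eq_bot']
    intro f hf
    by_contra h0
    have h1 := hW f f.2 (by simpa using h0)
    have h2 : V (f : E) = 0 := congrArg Subtype.val hf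
    simp [h2] at h1
  obtain ⟨c, hc, hcW⟩ := exists_forall_re_inner_le W hW
  let b := Module.finBasis ℂ W
  obtain ⟨D, hD⟩ : ∃ D : ℝ, 0 ≤ D ∧ ∀ w : W, ∑ i, ‖b.repr w i‖ ≤ D * ‖w‖ := by
    let e : W →L[ℂ] (Fin (Module.finrank ℂ W) → ℂ) :=
      LinearMap.toContinuousLinearMap (b.equivFun : W →ₗ[ℂ] _)
    refine ⟨Module.finrank ℂ W * ‖e‖, by positivity, fun w => ?_⟩
    calc ∑ i, ‖b.repr w i‖ ≤ ∑ i : Fin (Module.finrank ℂ W), ‖e‖ * ‖w‖ :=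
          Finset.sum_le_sum fun i _ => (norm_le_pi_norm (e w) i).trans (e.le_opNorm w)
      _ = _ := by simp [mul_assoc]
  -- Each basis vector will be corrected to have `T`-image of norm below `δ`. As `D` compares the
  -- `ℓ¹` norm of coordinates with the norm, the form of `A` is then at most `|C| (δ D)² ‖w‖²`,
  -- which must lose against `-c ‖w‖²`.
  obtain ⟨δ, hδ, hδc⟩ : ∃ δ > 0, |C| * (δ * D) ^ 2 < c := by
    have hlim : Filter.Tendsto (fun δ : ℝ => |C| * (δ * D) ^ 2) (nhds 0) (nhds 0) := by
      have : Continuous fun δ : ℝ => |C| * (δ * D) ^ 2 := by fun_prop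
      simpa using this.tendsto 0
    have h1 := (hlim.eventually (gt_mem_nhds hc)).filter_mono
      (nhdsWithin_le_nhds (s := Set.Ioi 0))
    obtain ⟨δ, h2, h3⟩ := (h1.and self_mem_nhdsWithin).exists
    exact ⟨δ, h3, h2⟩
  choose k hk hkδ using fun i => exists_sub_mem_orthogonal_norm_lt T F hF (b i : E) hδ
  let κ : W →ₗ[ℂ] E := b.constr ℂ k
  let R : W →ₗ[ℂ] E := W.subtype - κ
  have hκ : ∀ w, κ w ∈ Fᗮ := fun w => by
    simp only [κ, Module.Basis.constr_apply_fintype]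
    exact Submodule.sum_mem _ fun i _ => Submodule.smul_mem _ _ (hk i)
  have hTR : ∀ w, ‖T (R w)‖ ≤ δ * D * ‖w‖ := fun w => by
    have h1 : R w = ∑ i, b.repr w i • ((b i : E) - k i) := by
      have h2 : (w : E) = ∑ i, b.repr w i • (b i : E) := by
        have h3 := congrArg W.subtype (b.sum_repr w)
        simpa only [map_sum, map_smul, Submodule.subtype_apply] using h3.symm
      simp only [R, LinearMap.sub_apply, κ, Module.Basis.constr_apply_fintype,
        Submodule.subtype_apply, smul_sub, Finset.sum_sub_distrib, ← h2,
        Module.Basis.equivFun_apply]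
    rw [h1, map_sum]
    calc _ ≤ ∑ i, ‖b.repr w i‖ * δ := by
          refine norm_sum_le_of_le _ fun i _ => ?_
          rw [map_smul, norm_smul]
          exact mul_le_mul_of_nonneg_left (hkδ i).le (norm_nonneg _)
      _ ≤ _ := by
          rw [← Finset.sum_mul, mul_comm, mul_assoc]
          exact mul_le_mul_of_nonneg_left (hD.2 w) hδ.le
  have hneg : ∀ w, w ≠ 0 → (⟪R w, (A + V) (R w)⟫_ℂ).re < 0 := fun w hw => by
    have hVR : V (R w) = V w := by simp [R, hVk _ (hκ w)]
    have h1 : ⟪R w, V (R w)⟫_ℂ = ⟪(w : E), V w⟫_ℂ := by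
      rw [hVR]
      simp only [R, LinearMap.sub_apply, inner_sub_left, Submodule.subtype_apply]
      rw [Submodule.inner_left_of_mem_orthogonal (hVF _) (hκ w), sub_zero]
    have hw' : 0 < ‖w‖ := norm_pos_iff.2 hw
    have h2 := hcW w w.2
    have h3 : (⟪R w, A (R w)⟫_ℂ).re ≤ |C| * (δ * D * ‖w‖) ^ 2 :=
      (hAT _).trans (mul_le_mul (le_abs_self C)
        (pow_le_pow_left₀ (norm_nonneg _) (hTR w) 2) (by positivity) (abs_nonneg C))
    have h4 : |C| * (δ * D) ^ 2 * ‖w‖ ^ 2 < c * ‖w‖ ^ 2 := by gcongr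
    rw [add_apply, inner_add_right, Complex.add_re, h1]
    rw [Submodule.coe_norm] at *
    nlinarith
  have hRinj : Function.Injective R := by
    rw [← LinearMap.ker_eq_bot, LinearMap.ker_eq_bot']
    intro w hw
    by_contra h0
    simpa [hw] using hneg w h0
  have hfin := finrank_le_Nminus (hA.add hV) (LinearMap.range R) (by
    rintro _ ⟨w, rfl⟩ h0
    exact hneg w fun h => h0 (by simp [h]))
  rw [LinearMap.finrank_range_of_inj hRinj] at hfin
  refine le_trans (le_of_eq ?_) hfin
  change Cardinal.toENat (Module.rank ℂ W) = _
  rw [← Module.finrank_eq_rank, Cardinal.toENat_nat]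

end NegativeIndex

/-! ### Exponential polynomials -/

/-- The derivative has lower degree, so the top coefficient of the combination is `-β` times that of
`p`. -/
theorem eq_zero_of_derivative_sub_C_mul {β : ℂ} (hβ : β ≠ 0) {p : Polynomial ℂ}
    (h : p.derivative - Polynomial.C β * p = 0) : p = 0 := by
  by_contra hp
  have h1 := congrArg (fun q => Polynomial.coeff q p.natDegree) h
  simp only [Polynomial.coeff_sub, Polynomial.coeff_derivative, Polynomial.coeff_C_mul,
    Polynomial.coeff_natDegree, Polynomial.coeff_zero] at h1
  rw [Polynomial.coeff_eq_zero_of_natDegree_lt (Nat.lt_succ_self _)] at h1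
  simp [hβ, hp] at h1

theorem hasDerivAt_eval_mul_exp (p : Polynomial ℂ) (β : ℂ) (t : ℝ) :
    HasDerivAt (fun t : ℝ => p.eval (t : ℂ) * Complex.exp (-(β * t)))
      ((p.derivative - Polynomial.C β * p).eval (t : ℂ) * Complex.exp (-(β * t))) t := by
  have h : HasDerivAt (fun z : ℂ => p.eval z * Complex.exp (-(β * z)))
      (p.derivative.eval (t : ℂ) * Complex.exp (-(β * t)) +
        p.eval (t : ℂ) * (Complex.exp (-(β * t)) * (-(β * 1)))) (t : ℂ) :=
    (p.hasDerivAt _).mul (((hasDerivAt_id _).const_mul β).neg.cexp)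
  convert h.comp_ofReal using 1
  simp
  ring

/-- Differentiation lowers the degree of the free polynomial `q` and replaces `p i` by `p i' - β i p
i`, an injective operation as `β i ≠ 0`. Repeating it until `q = 0` reduces to `hs`. -/
theorem expPoly_eq_zero_of_add {ι : Type*} (s : Finset ι)
    (hs : ∀ (β : ι → ℂ) (p : ι → Polynomial ℂ), Set.InjOn β s →
      (∀ t : ℝ, 0 < t → ∑ i ∈ s, (p i).eval (t : ℂ) * Complex.exp (-(β i * t)) = 0) →
      ∀ i ∈ s, p i = 0) (β : ι → ℂ) (hβ : Set.InjOn β s) (hβ0 : ∀ i ∈ s, β i ≠ 0) (n : ℕ) :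
    ∀ (p : ι → Polynomial ℂ) (q : Polynomial ℂ), q.degree < n →
      (∀ t : ℝ, 0 < t →
        ∑ i ∈ s, (p i).eval (t : ℂ) * Complex.exp (-(β i * t)) + q.eval (t : ℂ) = 0) →
      ∀ i ∈ s, p i = 0 := by
  induction n with
  | zero =>
    intro p q hq h
    have hq0 : q = 0 := by simpa using hq
    exact hs β p hβ fun t ht => by simpa [hq0] using h t ht
  | succ n ih =>
    intro p q hq h i hi
    refine eq_zero_of_derivative_sub_C_mul (hβ0 i hi)
      (ih (fun i => (p i).derivative - Polynomial.C (β i) * p i) q.derivative ?_ ?_ i hi)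
    · by_cases hq0 : q = 0
      · simp [hq0, bot_lt_iff_ne_bot]
      · refine (Polynomial.degree_derivative_lt hq0).trans_le ?_
        rw [Polynomial.degree_eq_natDegree hq0] at hq ⊢
        have hq' : q.natDegree < n + 1 := by exact_mod_cast hq
        exact_mod_cast Nat.lt_succ_iff.1 hq'
    · intro t ht
      have h1 : HasDerivAt (fun t : ℝ => ∑ i ∈ s, (p i).eval (t : ℂ) *
          Complex.exp (-(β i * t)) + q.eval (t : ℂ))
          (∑ i ∈ s, ((p i).derivative - Polynomial.C (β i) * p i).eval (t : ℂ) *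
            Complex.exp (-(β i * t)) + q.derivative.eval (t : ℂ)) t :=
        (HasDerivAt.fun_sum fun i _ => hasDerivAt_eval_mul_exp (p i) (β i) t).add
          (q.hasDerivAt _).comp_ofReal
      refine h1.unique ((hasDerivAt_const t (0 : ℂ)).congr_of_eventuallyEq ?_)
      filter_upwards [lt_mem_nhds ht] with u hu using h u hu

theorem expPoly_eq_zero {ι : Type*} (s : Finset ι) : ∀ (β : ι → ℂ) (p : ι → Polynomial ℂ),
    Set.InjOn β s →
      (∀ t : ℝ, 0 < t → ∑ i ∈ s, (p i).eval (t : ℂ) * Complex.exp (-(β i * t)) = 0) →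
      ∀ i ∈ s, p i = 0 := by
  classical
  induction s using Finset.induction_on with
  | empty => simp
  | insert j s hj ih =>
    intro β p hβ h
    have hβs : Set.InjOn (fun i => β i - β j) s := fun x hx y hy hxy =>
      hβ (by simp [Finset.mem_coe.1 hx]) (by simp [Finset.mem_coe.1 hy]) (by simpa using hxy)
    have hne : ∀ i ∈ s, β i - β j ≠ 0 := fun i hi h0 => hj <| by
      have := hβ (by simp [hi]) (by simp) (sub_eq_zero.1 h0)
      exact this ▸ hi
    have hps : ∀ i ∈ s, p i = 0 := by
      refine expPoly_eq_zero_of_add s ih _ hβs hne ((p j).natDegree + 1) p (p j) ?_ ?_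
      · exact Polynomial.degree_le_natDegree.trans_lt (by exact_mod_cast Nat.lt_succ_self _)
      · intro t ht
        -- Multiplying by `e^{β_j t}` makes the `j`-th exponent zero, so its term becomes the free
        -- polynomial and the other exponents become non-zero differences.
        have h1 := congrArg (· * Complex.exp (β j * t)) (h t ht)
        simp only [Finset.sum_insert hj, add_mul, Finset.sum_mul, zero_mul, mul_assoc,
          ← Complex.exp_add] at h1
        rw [neg_add_cancel, Complex.exp_zero, mul_one, add_comm] at h1
        rw [← h1]
        congr 1
        refine Finset.sum_congr rfl fun i _ => ?_
        congr 2
        ring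
    intro i hi
    rcases Finset.mem_insert.1 hi with rfl | hi
    · refine Polynomial.eq_zero_of_infinite_isRoot _ ?_
      refine ((Set.Ioi_infinite (0 : ℝ)).image Complex.ofReal_injective.injOn).mono ?_
      rintro _ ⟨t, ht, rfl⟩
      have h1 := h t ht
      rw [Finset.sum_insert hj, Finset.sum_eq_zero (fun i hi => by simp [hps i hi]), add_zero] at h1
      simpa [Polynomial.IsRoot] using h1
    · exact hps i hi

/-! ### Exponential monomials in `L²(ℝ₊)` -/

theorem norm_exp_neg_mul_ofReal (β : ℂ) (t : ℝ) :
    ‖Complex.exp (-(β * t))‖ = Real.exp (-(β.re * t)) := by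
  simp [Complex.norm_exp]

theorem memLp_expMonomial {β : ℂ} (hβ : 0 < β.re) (j : ℕ) :
    MemLp (fun t : ℝ => (t : ℂ) ^ j * Complex.exp (-(β * t))) 2
      (volume.restrict (Set.Ioi (0 : ℝ))) := by
  have hc : Continuous fun t : ℝ => (t : ℂ) ^ j * Complex.exp (-(β * t)) := by fun_prop
  rw [memLp_two_iff_integrable_sq_norm hc.aestronglyMeasurable]
  have h := integrableOn_rpow_mul_exp_neg_mul_rpow (s := ((2 * j : ℕ) : ℝ)) (p := 1)
    (b := 2 * β.re) (by have : (0 : ℝ) ≤ ((2 * j : ℕ) : ℝ) := by positivity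
                        linarith) one_pos (by linarith)
  refine h.congr_fun (fun t ht => ?_) measurableSet_Ioi
  have ht' : (0 : ℝ) < t := ht
  simp only [norm_mul, norm_pow, norm_exp_neg_mul_ofReal, mul_pow, Complex.norm_real,
    Real.norm_eq_abs, abs_of_pos ht', Real.rpow_natCast, Real.rpow_one, ← Real.exp_nat_mul]
  rw [← pow_mul, mul_comm j]
  congr 2
  push_cast
  ring

/-- The function `t ^ j e^{-βt}` in `L²(ℝ₊)`; zero if `Re β ≤ 0`. -/
noncomputable def expVec (β : ℂ) (j : ℕ) : L2Plus :=
  if h : 0 < β.re then (memLp_expMonomial h j).toLp _ else 0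

theorem coeFn_expVec {β : ℂ} (hβ : 0 < β.re) (j : ℕ) :
    expVec β j =ᵐ[volume.restrict (Set.Ioi (0 : ℝ))]
      fun t : ℝ => (t : ℂ) ^ j * Complex.exp (-(β * t)) := by
  rw [expVec, dif_pos hβ]
  exact MemLp.coeFn_toLp _

/-- The Hankel kernel pairs without conjugation; conjugating the exponent compensates for the
antilinear slot. This is why exponents appear in conjugate pairs in the form of `V`. -/
theorem inner_expVec_conj {β : ℂ} (hβ : 0 < β.re) (j : ℕ) (f : L2Plus) :
    ⟪expVec ((starRingEnd ℂ) β) j, f⟫_ℂ =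
      ∫ s in Set.Ioi (0 : ℝ), (s : ℂ) ^ j * Complex.exp (-(β * s)) * f s := by
  rw [L2.inner_def]
  refine integral_congr_ae ?_
  filter_upwards [coeFn_expVec (β := (starRingEnd ℂ) β) (by simpa using hβ) j] with s hs
  rw [hs, RCLike.inner_apply', map_mul, map_pow, Complex.conj_ofReal, ← Complex.exp_conj]
  simp

theorem integrable_expMonomial_mul {β : ℂ} (hβ : 0 < β.re) (j : ℕ) (f : L2Plus) :
    Integrable (fun s : ℝ => (s : ℂ) ^ j * Complex.exp (-(β * s)) * f s)
      (volume.restrict (Set.Ioi (0 : ℝ))) := by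
  exact (memLp_expMonomial hβ j).integrable_mul (Lp.memLp f)

theorem coeFn_finsetSum {ι : Type*} (s : Finset ι) (f : ι → L2Plus) :
    (∑ i ∈ s, f i : L2Plus) =ᵐ[volume.restrict (Set.Ioi (0 : ℝ))] fun t => ∑ i ∈ s, f i t := by
  classical
  induction s using Finset.induction_on with
  | empty =>
    simp only [Finset.sum_empty]
    exact Lp.coeFn_zero ℂ 2 (volume.restrict (Set.Ioi (0 : ℝ)))
  | insert j s hj ih =>
    rw [Finset.sum_insert hj]
    filter_upwards [Lp.coeFn_add (f j) (∑ i ∈ s, f i), ih] with t h1 h2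
    rw [h1, Pi.add_apply, h2, Finset.sum_insert hj]

theorem eqOn_Ioi_of_ae {f g : ℝ → ℂ} (hf : ContinuousOn f (Set.Ioi 0))
    (hg : ContinuousOn g (Set.Ioi 0)) (h : f =ᵐ[volume.restrict (Set.Ioi (0 : ℝ))] g) :
    Set.EqOn f g (Set.Ioi 0) :=
  Measure.eqOn_open_of_ae_eq h isOpen_Ioi hf hg

/-- A vanishing combination in `L²` is an exponential polynomial that is zero almost everywhere,
hence on all of `(0, ∞)` by continuity, and `expPoly_eq_zero` applies. -/
theorem linearIndependent_expVec {ι : Type*} [Fintype ι] (β : ι → ℂ) (hβ : ∀ i, 0 < (β i).re)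
    (hinj : Function.Injective β) (K : ι → ℕ) :
    LinearIndependent ℂ fun p : Σ i, Fin (K i) => expVec (β p.1) p.2 := by
  rw [Fintype.linearIndependent_iff]
  intro d hd
  let P : ι → Polynomial ℂ := fun i => ∑ a : Fin (K i), Polynomial.monomial a (d ⟨i, a⟩)
  have hP : ∀ t : ℝ, 0 < t →
      ∑ i, (P i).eval (t : ℂ) * Complex.exp (-(β i * t)) = 0 := by
    intro t ht
    refine eqOn_Ioi_of_ae (f := fun t : ℝ => ∑ i, (P i).eval (t : ℂ) * Complex.exp (-(β i * t)))
      (g := fun _ => 0) (Continuous.continuousOn ?_) continuousOn_const ?_ ht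
    · refine continuous_finsetSum _ fun i _ => ?_
      have := (P i).continuous
      fun_prop
    have h0 := Lp.coeFn_zero ℂ 2 (volume.restrict (Set.Ioi (0 : ℝ)))
    rw [← hd] at h0
    have hall : ∀ᵐ t ∂(volume.restrict (Set.Ioi (0 : ℝ))), ∀ p : Σ i, Fin (K i),
        (d p • expVec (β p.1) p.2 : L2Plus) t =
          d p * ((t : ℂ) ^ (p.2 : ℕ) * Complex.exp (-(β p.1 * t))) := by
      refine ae_all_iff.2 fun p => ?_
      filter_upwards [Lp.coeFn_smul (d p) (expVec (β p.1) p.2), coeFn_expVec (hβ p.1) p.2]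
        with t h1 h2
      rw [h1, Pi.smul_apply, h2, smul_eq_mul]
    filter_upwards [h0, hall, coeFn_finsetSum Finset.univ
      fun p : Σ i, Fin (K i) => d p • expVec (β p.1) p.2] with t h1 h2 h3
    rw [h3] at h1
    simp only [h2, Fintype.sum_sigma] at h1
    simp only [P, Polynomial.eval_finsetSum, Polynomial.eval_monomial, Finset.sum_mul, mul_assoc]
    exact h1
  rintro ⟨i, a⟩
  have h1 := expPoly_eq_zero Finset.univ β P hinj.injOn hP i (Finset.mem_univ i)
  have h2 := congrArg (fun q => Polynomial.coeff q a) h1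
  simpa [P, Polynomial.finsetSum_coeff, Polynomial.coeff_monomial, Fin.val_inj] using h2

/-- Taylor expansion, padded to a square of indices: the terms with `a + b > deg R` vanish, and the
square makes the symmetry in `a` and `b` visible. -/
theorem eval_add_eq_sum (R : Polynomial ℂ) (s t : ℂ) :
    R.eval (t + s) = ∑ a ∈ Finset.range (R.natDegree + 1), ∑ b ∈ Finset.range (R.natDegree + 1),
      R.coeff (a + b) * ((a + b).choose a : ℂ) * (s ^ a * t ^ b) := by
  have h1 : R.eval (t + s) = (Polynomial.taylor t R).eval s := by
    rw [Polynomial.taylor_eval, add_comm]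
  rw [h1, Polynomial.eval_eq_sum_range, Polynomial.natDegree_taylor]
  refine Finset.sum_congr rfl fun a _ => ?_
  rw [Polynomial.taylor_coeff, Polynomial.eval_eq_sum_range' (n := R.natDegree + 1)
    ((Polynomial.natDegree_hasseDeriv_le R a).trans_lt (by omega)), Finset.sum_mul]
  refine Finset.sum_congr rfl fun b _ => ?_
  rw [Polynomial.hasseDeriv_coeff, add_comm b a]
  ring

/-! ### Finite rank Hankel operators -/

/-- The coefficient of `sᵃ tᵇ` in `R (s + t)`. -/
noncomputable def addCoeff (R : Polynomial ℂ) (a b : ℕ) : ℂ :=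
  R.coeff (a + b) * ((a + b).choose a : ℂ)

theorem addCoeff_eq_zero {R : Polynomial ℂ} {a b : ℕ} (h : R.natDegree < a + b) :
    addCoeff R a b = 0 := by
  rw [addCoeff, Polynomial.coeff_eq_zero_of_natDegree_lt h, zero_mul]

theorem addCoeff_comm (R : Polynomial ℂ) (a b : ℕ) : addCoeff R a b = addCoeff R b a := by
  rw [addCoeff, addCoeff, add_comm b a, ← Nat.choose_symm_add]

theorem addCoeff_map_conj (R : Polynomial ℂ) (a b : ℕ) :
    addCoeff (R.map (starRingEnd ℂ)) a b = (starRingEnd ℂ) (addCoeff R a b) := by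
  simp [addCoeff]

section FiniteRank

variable {ι : Type*} [Fintype ι] {β : ι → ℂ} {R : ι → Polynomial ℂ} {V : L2Plus →L[ℂ] L2Plus}

/-- The addition formulas for powers and exponentials separate `t` from `s` in `v(t + s)`, so `V` is
a finite sum of rank one operators. -/
theorem hankel_apply (hβ : ∀ i, 0 < (β i).re)
    (hV : IsHankelIntegralOperator V
      fun t => ∑ i, (R i).eval (t : ℂ) * Complex.exp (-(β i * t))) (f : L2Plus) :
    V f = ∑ i, ∑ a ∈ Finset.range ((R i).natDegree + 1),
      ∑ b ∈ Finset.range ((R i).natDegree + 1),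
        (addCoeff (R i) a b * ⟪expVec ((starRingEnd ℂ) (β i)) a, f⟫_ℂ) • expVec (β i) b := by
  refine Lp.ext ?_
  have hall : ∀ᵐ t ∂(volume.restrict (Set.Ioi (0 : ℝ))), ∀ i, ∀ b : ℕ,
      expVec (β i) b t = (t : ℂ) ^ b * Complex.exp (-(β i * t)) :=
    ae_all_iff.2 fun i => ae_all_iff.2 fun b => coeFn_expVec (hβ i) b
  have hsmul : ∀ᵐ t ∂(volume.restrict (Set.Ioi (0 : ℝ))), ∀ i, ∀ a b : ℕ,
      ((addCoeff (R i) a b * ⟪expVec ((starRingEnd ℂ) (β i)) a, f⟫_ℂ) • expVec (β i) b : L2Plus) t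
        = (addCoeff (R i) a b * ⟪expVec ((starRingEnd ℂ) (β i)) a, f⟫_ℂ) * expVec (β i) b t :=
    ae_all_iff.2 fun i => ae_all_iff.2 fun a => ae_all_iff.2 fun b => Lp.coeFn_smul _ _
  have hsum₁ := coeFn_finsetSum Finset.univ fun i =>
    ∑ a ∈ Finset.range ((R i).natDegree + 1), ∑ b ∈ Finset.range ((R i).natDegree + 1),
        (addCoeff (R i) a b * ⟪expVec ((starRingEnd ℂ) (β i)) a, f⟫_ℂ) • expVec (β i) b
  have hsum₂ := ae_all_iff.2 fun i => coeFn_finsetSum (Finset.range ((R i).natDegree + 1)) fun a =>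
    ∑ b ∈ Finset.range ((R i).natDegree + 1),
        (addCoeff (R i) a b * ⟪expVec ((starRingEnd ℂ) (β i)) a, f⟫_ℂ) • expVec (β i) b
  have hsum₃ := ae_all_iff.2 fun i => ae_all_iff.2 fun a =>
    coeFn_finsetSum (Finset.range ((R i).natDegree + 1)) fun b =>
        (addCoeff (R i) a b * ⟪expVec ((starRingEnd ℂ) (β i)) a, f⟫_ℂ) • expVec (β i) b
  filter_upwards [hV f, hall, hsmul, hsum₁, hsum₂, hsum₃] with t h1 h2 h3 h4 h5 h6
  simp only [h1, h4, h5, h6, h3, h2]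
  have key : ∀ s : ℝ, (∑ i, (R i).eval ((t + s : ℝ) : ℂ) * Complex.exp (-(β i * (t + s : ℝ)))) *
      f s = ∑ i, ∑ a ∈ Finset.range ((R i).natDegree + 1),
        ∑ b ∈ Finset.range ((R i).natDegree + 1),
          addCoeff (R i) a b * ((t : ℂ) ^ b * Complex.exp (-(β i * t))) *
            ((s : ℂ) ^ a * Complex.exp (-(β i * s)) * f s) := fun s => by
    rw [Finset.sum_mul]
    refine Finset.sum_congr rfl fun i _ => ?_
    push_cast
    rw [eval_add_eq_sum, mul_add, neg_add, Complex.exp_add]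
    simp only [Finset.sum_mul]
    refine Finset.sum_congr rfl fun a _ => Finset.sum_congr rfl fun b _ => ?_
    rw [addCoeff]
    ring
  simp only [key]
  have hInt : ∀ i, ∀ a b : ℕ, Integrable (fun s : ℝ =>
      addCoeff (R i) a b * ((t : ℂ) ^ b * Complex.exp (-(β i * t))) *
            ((s : ℂ) ^ a * Complex.exp (-(β i * s)) * f s))
      (volume.restrict (Set.Ioi (0 : ℝ))) := fun i a b =>
    (integrable_expMonomial_mul (hβ i) a f).const_mul _
  rw [integral_finsetSum _ fun i _ => integrable_finsetSum _ fun a _ =>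
    integrable_finsetSum _ fun b _ => hInt i a b]
  refine Finset.sum_congr rfl fun i _ => ?_
  rw [integral_finsetSum _ fun a _ => integrable_finsetSum _ fun b _ => hInt i a b]
  refine Finset.sum_congr rfl fun a _ => ?_
  rw [integral_finsetSum _ fun b _ => hInt i a b]
  refine Finset.sum_congr rfl fun b _ => ?_
  rw [integral_const_mul, inner_expVec_conj (hβ i)]
  ring

/-- The matrix elements of a finite rank Hankel operator whose exponents `β i` are permuted by
complex conjugation. -/
theorem inner_hankel_apply {σ : ι → ι} (hβσ : ∀ i, β (σ i) = (starRingEnd ℂ) (β i))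
    (hβ : ∀ i, 0 < (β i).re)
    (hV : IsHankelIntegralOperator V
      fun t => ∑ i, (R i).eval (t : ℂ) * Complex.exp (-(β i * t))) (f g : L2Plus) :
    ⟪g, V f⟫_ℂ = ∑ i, ∑ a ∈ Finset.range ((R i).natDegree + 1),
      ∑ b ∈ Finset.range ((R i).natDegree + 1),
        addCoeff (R i) a b * ⟪expVec (β (σ i)) a, f⟫_ℂ * ⟪g, expVec (β i) b⟫_ℂ := by
  simp only [hankel_apply hβ hV f, inner_sum, inner_smul_right, hβσ]

theorem isSelfAdjoint_hankel {σ : ι → ι} (hσ : Function.Involutive σ)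
    (hβσ : ∀ i, β (σ i) = (starRingEnd ℂ) (β i))
    (hRσ : ∀ i, R (σ i) = (R i).map (starRingEnd ℂ)) (hβ : ∀ i, 0 < (β i).re)
    (hV : IsHankelIntegralOperator V
      fun t => ∑ i, (R i).eval (t : ℂ) * Complex.exp (-(β i * t))) :
    IsSelfAdjoint V := by
  rw [ContinuousLinearMap.isSelfAdjoint_iff_isSymmetric]
  intro f g
  simp only [ContinuousLinearMap.coe_coe]
  rw [← inner_conj_symm, inner_hankel_apply hβσ hβ hV, inner_hankel_apply hβσ hβ hV]
  simp only [map_sum, map_mul, inner_conj_symm]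
  -- Conjugating the form exchanges `β i` with its conjugate and `a` with `b`; reindexing by `σ` and
  -- using `addCoeff_comm` restores it.
  rw [← Equiv.sum_comp hσ.toPerm]
  refine Finset.sum_congr rfl fun i _ => ?_
  have hdeg : (R (σ i)).natDegree = (R i).natDegree := by
    rw [hRσ, Polynomial.natDegree_map]
  simp only [Function.Involutive.coe_toPerm, hdeg, hσ i]
  rw [Finset.sum_comm]
  refine Finset.sum_congr rfl fun a _ => Finset.sum_congr rfl fun b _ => ?_
  rw [hRσ, addCoeff_map_conj, Complex.conj_conj, addCoeff_comm]
  ring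

/-- Entries beyond the antidiagonal `a + b = deg P` vanish, and those on it are the leading
coefficient times a binomial coefficient. Row `b = deg P - a` therefore determines `x a` from the
earlier components. -/
theorem eq_zero_of_antitriangular {P : Polynomial ℂ} (hP : P ≠ 0) (x : ℕ → ℂ)
    (h : ∀ b ∈ Finset.range (P.natDegree + 1),
      ∑ a ∈ Finset.range (P.natDegree + 1), addCoeff P a b * x a = 0) :
    ∀ a ≤ P.natDegree, x a = 0 := by
  intro a
  induction a using Nat.strong_induction_on with
  | _ a ih =>
    intro ha
    have h1 := h (P.natDegree - a) (Finset.mem_range.2 (by omega))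
    rw [Finset.sum_eq_single a] at h1
    · refine (mul_eq_zero.1 h1).resolve_left ?_
      rw [addCoeff, Nat.add_sub_cancel' ha]
      refine mul_ne_zero ?_ ?_
      · simpa using hP
      · exact_mod_cast (Nat.choose_pos ha).ne'
    · intro c hc hca
      rcases lt_or_gt_of_ne hca with hlt | hgt
      · rw [ih c hlt (by omega), mul_zero]
      · rw [addCoeff_eq_zero (by omega), zero_mul]
    · intro hn
      exact absurd (Finset.mem_range.2 (by omega)) hn

theorem inner_expVec_eq_zero_of_hankel_eq_zero {σ : ι → ι} (hσ : Function.Involutive σ)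
    (hβσ : ∀ i, β (σ i) = (starRingEnd ℂ) (β i)) (hR : ∀ i, R i ≠ 0)
    (hRσ : ∀ i, R (σ i) = (R i).map (starRingEnd ℂ)) (hβ : ∀ i, 0 < (β i).re)
    (hinj : Function.Injective β)
    (hV : IsHankelIntegralOperator V
      fun t => ∑ i, (R i).eval (t : ℂ) * Complex.exp (-(β i * t))) {f : L2Plus} (hf : V f = 0)
    (i : ι) {a : ℕ} (ha : a ≤ (R i).natDegree) : ⟪expVec (β i) a, f⟫_ℂ = 0 := by
  have hli := linearIndependent_expVec β hβ hinj fun i => (R i).natDegree + 1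
  rw [Fintype.linearIndependent_iff] at hli
  have h0 := hli (fun p => ∑ a ∈ Finset.range ((R p.1).natDegree + 1),
      addCoeff (R p.1) a p.2 * ⟪expVec (β (σ p.1)) a, f⟫_ℂ) (by
    rw [Fintype.sum_sigma, ← hf, hankel_apply hβ hV f]
    refine Finset.sum_congr rfl fun i _ => ?_
    rw [Finset.sum_comm, Finset.sum_range]
    simp only [Finset.sum_smul, hβσ])
  -- The coefficients of `expVec (β (σ i)) b` in `V f = 0` involve the moments against exponent `σ
  -- (σ i) = i`, so the system is read at the index `σ i`.
  have h1 := eq_zero_of_antitriangular (hR (σ i)) (fun a => ⟪expVec (β (σ (σ i))) a, f⟫_ℂ)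
    (fun b hb => h0 ⟨σ i, ⟨b, Finset.mem_range.1 hb⟩⟩) a
  rw [hσ i, hRσ, Polynomial.natDegree_map] at h1
  exact h1 ha

/-- If `V f = 0` then `f` is orthogonal to the span of the exponential monomials. A vector of that
span killed by `V` is thus orthogonal to itself, so `V` is injective on the span. -/
theorem sum_le_rank_hankel {σ : ι → ι} (hσ : Function.Involutive σ)
    (hβσ : ∀ i, β (σ i) = (starRingEnd ℂ) (β i)) (hR : ∀ i, R i ≠ 0)
    (hRσ : ∀ i, R (σ i) = (R i).map (starRingEnd ℂ)) (hβ : ∀ i, 0 < (β i).re)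
    (hinj : Function.Injective β)
    (hV : IsHankelIntegralOperator V
      fun t => ∑ i, (R i).eval (t : ℂ) * Complex.exp (-(β i * t))) :
    ((∑ i, ((R i).natDegree + 1) : ℕ) : ℕ∞) ≤
      Cardinal.toENat (Module.rank ℂ (LinearMap.range (V : L2Plus →ₗ[ℂ] L2Plus))) := by
  have hli := linearIndependent_expVec β hβ hinj fun i => (R i).natDegree + 1
  let F := Submodule.span ℂ (Set.range fun p : Σ i, Fin ((R i).natDegree + 1) =>
    expVec (β p.1) p.2)
  let J : F →ₗ[ℂ] LinearMap.range (V : L2Plus →ₗ[ℂ] L2Plus) :=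
    (V : L2Plus →ₗ[ℂ] L2Plus).rangeRestrict ∘ₗ F.subtype
  have hJ : Function.Injective J := by
    rw [← LinearMap.ker_eq_bot, LinearMap.ker_eq_bot']
    intro f hf
    have hVf : V (f : L2Plus) = 0 := congrArg Subtype.val hf
    have hperp : ∀ g ∈ F, ⟪g, (f : L2Plus)⟫_ℂ = 0 := by
      intro g hg
      induction hg using Submodule.span_induction with
      | mem g hg =>
        obtain ⟨p, rfl⟩ := hg
        exact inner_expVec_eq_zero_of_hankel_eq_zero hσ hβσ hR hRσ hβ hinj hV hVf p.1
          (Nat.lt_succ_iff.1 p.2.2)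
      | zero => exact inner_zero_left _
      | add x y _ _ hx hy => rw [inner_add_left, hx, hy, add_zero]
      | smul c x _ hx => rw [inner_smul_left, hx, mul_zero]
    exact Subtype.ext (inner_self_eq_zero.1 (hperp f f.2))
  have h1 := Cardinal.toENat.monotone' (LinearMap.rank_le_of_injective J hJ)
  refine le_trans (le_of_eq ?_) h1
  change _ = Cardinal.toENat (Module.rank ℂ F)
  have : FiniteDimensional ℂ F := FiniteDimensional.span_of_finite ℂ (Set.finite_range _)
  rw [← Module.finrank_eq_rank, finrank_span_eq_card hli, Cardinal.toENat_nat]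
  simp

theorem hankel_term_eq_zero (P : Polynomial ℂ) {r r' : ℕ} (h : P.natDegree < r + r') (x y : ℕ → ℂ)
    (hx : ∀ a < r, x a = 0) (hy : ∀ b < r', y b = 0) :
    ∑ a ∈ Finset.range (P.natDegree + 1), ∑ b ∈ Finset.range (P.natDegree + 1),
      addCoeff P a b * x a * y b = 0 := by
  refine Finset.sum_eq_zero fun a _ => Finset.sum_eq_zero fun b _ => ?_
  by_cases ha : a < r
  · rw [hx a ha, mul_zero, zero_mul]
  by_cases hb : b < r'
  · rw [hy b hb, mul_zero]
  · rw [addCoeff_eq_zero (by omega), zero_mul, zero_mul]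

/-- Surviving indices satisfy `a ≥ r`, `b ≥ r` and `a + b ≤ 2r`, which leaves only `a = b = r`. -/
theorem hankel_term_eq_middle (P : Polynomial ℂ) {r : ℕ} (h : P.natDegree = 2 * r) (x y : ℕ → ℂ)
    (hx : ∀ a < r, x a = 0) (hy : ∀ b < r, y b = 0) :
    ∑ a ∈ Finset.range (P.natDegree + 1), ∑ b ∈ Finset.range (P.natDegree + 1),
      addCoeff P a b * x a * y b = addCoeff P r r * (x r * y r) := by
  rw [Finset.sum_eq_single r, Finset.sum_eq_single r, mul_assoc]
  · intro b _ hb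
    rcases lt_or_gt_of_ne hb with hlt | hgt
    · rw [hy b hlt, mul_zero]
    · rw [addCoeff_eq_zero (by omega), zero_mul, zero_mul]
  · intro hr
    exact absurd (Finset.mem_range.2 (by omega)) hr
  · intro a _ ha
    rcases lt_or_gt_of_ne ha with hlt | hgt
    · exact Finset.sum_eq_zero fun b _ => by rw [hx a hlt, mul_zero, zero_mul]
    · refine Finset.sum_eq_zero fun b _ => ?_
      by_cases hb : b < r
      · rw [hy b hb, mul_zero]
      · rw [addCoeff_eq_zero (by omega), zero_mul, zero_mul]
  · intro hr
    exact absurd (Finset.mem_range.2 (by omega)) hr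

end FiniteRank

theorem re_hankel_term_middle (P : Polynomial ℝ) {r : ℕ} (h : P.natDegree = 2 * r) (x : ℕ → ℂ)
    (hx : ∀ a < r, x a = 0) :
    (∑ a ∈ Finset.range ((P.map Complex.ofRealHom).natDegree + 1),
      ∑ b ∈ Finset.range ((P.map Complex.ofRealHom).natDegree + 1),
        addCoeff (P.map Complex.ofRealHom) a b * x a * (starRingEnd ℂ) (x b)).re =
      P.leadingCoeff * ((r + r).choose r * ‖x r‖ ^ 2) := by
  have hdeg : (P.map Complex.ofRealHom).natDegree = P.natDegree := Polynomial.natDegree_map _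
  rw [hankel_term_eq_middle _ (hdeg.trans h) x _ hx fun b hb => by rw [hx b hb, map_zero],
    Complex.mul_conj, addCoeff, Polynomial.coeff_map, ← two_mul, ← h, Polynomial.coeff_natDegree,
    Complex.normSq_eq_norm_sq, Complex.ofRealHom_eq_coe]
  norm_cast
  ring

theorem negNumber_le (P : Polynomial ℝ) : negNumber P ≤ P.natDegree + 1 := by
  unfold negNumber
  split_ifs <;> omega

/-- If twice the cut exceeds the degree, nothing survives. The only other case is even degree with
positive leading coefficient, where the middle square remains with a positive factor. -/
theorem re_hankel_term_nonneg {P : Polynomial ℝ} (x : ℕ → ℂ) (hx : ∀ a < negNumber P, x a = 0) :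
    0 ≤ (∑ a ∈ Finset.range ((P.map Complex.ofRealHom).natDegree + 1),
      ∑ b ∈ Finset.range ((P.map Complex.ofRealHom).natDegree + 1),
        addCoeff (P.map Complex.ofRealHom) a b * x a * (starRingEnd ℂ) (x b)).re := by
  have hdeg : (P.map Complex.ofRealHom).natDegree = P.natDegree := Polynomial.natDegree_map _
  have hy : ∀ b < negNumber P, (starRingEnd ℂ) (x b) = 0 := fun b hb => by rw [hx b hb, map_zero]
  by_cases h : P.natDegree < negNumber P + negNumber P
  · rw [hankel_term_eq_zero _ (hdeg ▸ h) x _ hx hy, Complex.zero_re]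
  · have hN := h
    unfold negNumber at hN
    split_ifs at hN with h1 h2
    · obtain ⟨m, hm⟩ := h1
      omega
    · have h3 : negNumber P = P.natDegree / 2 := by rw [negNumber, if_neg h1, if_pos h2]
      rw [Nat.not_odd_iff_even] at h1
      rw [re_hankel_term_middle P (Nat.two_mul_div_two_of_even h1).symm x (h3 ▸ hx)]
      have : 0 < P.leadingCoeff := by
        rwa [mul_pos_iff_of_pos_left (by positivity)] at h2
      positivity
    · omega

/-- The mirror image with the complementary cut: a middle square survives only for even degree when
the leading coefficient is not positive. -/
theorem re_hankel_term_nonpos {P : Polynomial ℝ} (x : ℕ → ℂ)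
    (hx : ∀ a < P.natDegree + 1 - negNumber P, x a = 0) :
    (∑ a ∈ Finset.range ((P.map Complex.ofRealHom).natDegree + 1),
      ∑ b ∈ Finset.range ((P.map Complex.ofRealHom).natDegree + 1),
        addCoeff (P.map Complex.ofRealHom) a b * x a * (starRingEnd ℂ) (x b)).re ≤ 0 := by
  have hdeg : (P.map Complex.ofRealHom).natDegree = P.natDegree := Polynomial.natDegree_map _
  set r := P.natDegree + 1 - negNumber P with hr
  have hy : ∀ b < r, (starRingEnd ℂ) (x b) = 0 := fun b hb => by rw [hx b hb, map_zero]
  by_cases h : P.natDegree < r + r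
  · rw [hankel_term_eq_zero _ (hdeg ▸ h) x _ hx hy, Complex.zero_re]
  · have hN := h
    rw [hr] at hN
    unfold negNumber at hN
    split_ifs at hN with h1 h2
    · obtain ⟨m, hm⟩ := h1
      omega
    · rw [Nat.not_odd_iff_even] at h1
      obtain ⟨m, hm⟩ := h1
      omega
    · have h3 : negNumber P = P.natDegree / 2 + 1 := by rw [negNumber, if_neg h1, if_neg h2]
      rw [Nat.not_odd_iff_even] at h1
      have h4 : P.natDegree = 2 * r := by
        obtain ⟨m, hm⟩ := h1
        omega
      rw [re_hankel_term_middle P h4 x hx]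
      have : P.leadingCoeff ≤ 0 := by
        by_contra hc
        exact h2 (mul_pos (by positivity) (not_le.1 hc))
      exact mul_nonpos_of_nonpos_of_nonneg this (by positivity)

/-! ### Inertia of the finite rank operator -/

namespace FiniteRankKernel

variable (k : FiniteRankKernel)

/-- All exponents of the kernel: the real ones, those in the upper half-plane and their
conjugates. -/
noncomputable def exponent : Fin k.M₀ ⊕ (Fin k.M₁ ⊕ Fin k.M₁) → ℂ :=
  Sum.elim (fun m => (k.α m : ℂ)) (Sum.elim k.γ fun m => (starRingEnd ℂ) (k.γ m))

/-- The polynomials that go with `FiniteRankKernel.exponent`. -/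
noncomputable def poly : Fin k.M₀ ⊕ (Fin k.M₁ ⊕ Fin k.M₁) → Polynomial ℂ :=
  Sum.elim (fun m => (k.P m).map Complex.ofRealHom)
    (Sum.elim k.Q fun m => (k.Q m).map (starRingEnd ℂ))

/-- The permutation of the exponents by complex conjugation. -/
def conjIndex : Fin k.M₀ ⊕ (Fin k.M₁ ⊕ Fin k.M₁) → Fin k.M₀ ⊕ (Fin k.M₁ ⊕ Fin k.M₁) :=
  Sum.map id Sum.swap

theorem conjIndex_involutive : Function.Involutive k.conjIndex := by
  rintro (m | m | m) <;> rfl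

theorem exponent_conjIndex (i) : k.exponent (k.conjIndex i) = (starRingEnd ℂ) (k.exponent i) := by
  rcases i with m | m | m <;> simp [exponent, conjIndex]

theorem poly_conjIndex (i) : k.poly (k.conjIndex i) = (k.poly i).map (starRingEnd ℂ) := by
  rcases i with m | m | m
  · simp only [poly, conjIndex, Sum.map_inl, Sum.elim_inl, id, Polynomial.map_map]
    congr 1
    ext x
    simp
  · simp [poly, conjIndex]
  · simp only [poly, conjIndex, Sum.map_inr, Sum.swap_inr, Sum.elim_inr, Sum.elim_inl,
      Polynomial.map_map]
    convert Polynomial.map_id.symm using 2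
    ext x
    simp

theorem exponent_re_pos (i) : 0 < (k.exponent i).re := by
  rcases i with m | m | m
  · simpa [exponent] using k.α_pos m
  · simpa [exponent] using k.γ_re m
  · simpa [exponent] using k.γ_re m

theorem exponent_injective : Function.Injective k.exponent := by
  rintro (m | m | m) (n | n | n) h
  all_goals
    have hre := congrArg Complex.re h
    have him := congrArg Complex.im h
    simp only [exponent, Sum.elim_inl, Sum.elim_inr, Complex.ofReal_re, Complex.ofReal_im,
      Complex.conj_re, Complex.conj_im] at h hre him
  · rw [k.α_inj hre]
  · linarith [k.γ_im n]
  · linarith [k.γ_im n]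
  · linarith [k.γ_im m]
  · rw [k.γ_inj h]
  · linarith [k.γ_im m, k.γ_im n]
  · linarith [k.γ_im m]
  · linarith [k.γ_im m, k.γ_im n]
  · rw [k.γ_inj ((starRingEnd ℂ).injective h)]

theorem poly_ne_zero (i) : k.poly i ≠ 0 := by
  rcases i with m | m | m
  · simpa [poly, Polynomial.map_eq_zero] using k.P_ne m
  · simpa [poly] using k.Q_ne m
  · simpa [poly, Polynomial.map_eq_zero] using k.Q_ne m

theorem kernel_eq : k.kernel =
    fun t : ℝ => ∑ i, (k.poly i).eval (t : ℂ) * Complex.exp (-(k.exponent i * t)) := by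
  ext t
  simp only [kernel, Fintype.sum_sum_type, exponent, poly, Sum.elim_inl, Sum.elim_inr,
    Finset.sum_add_distrib]
  congr 1
  · refine Finset.sum_congr rfl fun m _ => ?_
    congr 1
    exact (Polynomial.eval_map_apply (p := k.P m) (f := Complex.ofRealHom) t).symm
  · congr 1
    refine Finset.sum_congr rfl fun m _ => ?_
    congr 1
    have := Polynomial.eval_map_apply (p := k.Q m) (f := starRingEnd ℂ) (t : ℂ)
    rw [Complex.conj_ofReal] at this
    exact this.symm

/-- The number of functionals `⟪t ^ a e^{-βt}, ·⟫`, `a = 0, 1, …`, on whose common kernel the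
operator is non-negative. -/
noncomputable def negCut : Fin k.M₀ ⊕ (Fin k.M₁ ⊕ Fin k.M₁) → ℕ :=
  Sum.elim (fun m => negNumber (k.P m)) (Sum.elim (fun m => (k.Q m).natDegree + 1) fun _ => 0)

/-- The number of functionals `⟪t ^ a e^{-βt}, ·⟫`, `a = 0, 1, …`, on whose common kernel the
operator is non-positive. -/
noncomputable def posCut : Fin k.M₀ ⊕ (Fin k.M₁ ⊕ Fin k.M₁) → ℕ :=
  Sum.elim (fun m => (k.P m).natDegree + 1 - negNumber (k.P m))
    (Sum.elim (fun m => (k.Q m).natDegree + 1) fun _ => 0)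

theorem sum_negCut : ∑ i, k.negCut i = k.totalNeg := by
  simp [negCut, totalNeg, Fintype.sum_sum_type, Finset.sum_add_distrib, add_assoc]

/-- A real exponent contributes `K + 1` in total. A conjugate pair contributes `K + 1` to each cut,
matching its two polynomials of degree `K`. -/
theorem sum_negCut_add_sum_posCut :
    ∑ i, k.negCut i + ∑ i, k.posCut i = ∑ i, ((k.poly i).natDegree + 1) := by
  have h : ∀ m, negNumber (k.P m) + ((k.P m).natDegree + 1 - negNumber (k.P m)) =
      (k.P m).natDegree + 1 := fun m => Nat.add_sub_cancel' (negNumber_le _)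
  simp only [negCut, posCut, poly, Fintype.sum_sum_type, Sum.elim_inl, Sum.elim_inr,
    Polynomial.natDegree_map]
  have h' := Finset.sum_congr (rfl : (Finset.univ : Finset (Fin k.M₀)) = _) fun m _ => h m
  rw [Finset.sum_add_distrib] at h'
  rw [← h', Finset.sum_const_zero]
  ring

variable {V : L2Plus →L[ℂ] L2Plus}

theorem isSelfAdjoint (hV : IsHankelIntegralOperator V k.kernel) : IsSelfAdjoint V := by
  rw [kernel_eq] at hV
  exact isSelfAdjoint_hankel k.conjIndex_involutive k.exponent_conjIndex k.poly_conjIndex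
    k.exponent_re_pos hV

theorem re_inner_nonneg (hV : IsHankelIntegralOperator V k.kernel) {f : L2Plus}
    (hf : ∀ i, ∀ a < k.negCut i, ⟪expVec (k.exponent i) a, f⟫_ℂ = 0) :
    0 ≤ (⟪f, V f⟫_ℂ).re := by
  rw [kernel_eq] at hV
  rw [inner_hankel_apply k.exponent_conjIndex k.exponent_re_pos hV, Complex.re_sum]
  refine Finset.sum_nonneg fun i _ => ?_
  simp only [← inner_conj_symm f (expVec _ _)]
  rcases i with m | m | m
  · exact re_hankel_term_nonneg _ (hf (Sum.inl m))
  -- Every product in the blocks of a non-real pair contains one moment against `γ` and one against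
  -- its conjugate. Killing the moments of `γ` alone annihilates both blocks: here through the
  -- second factor, in the conjugate block through the first.
  · rw [hankel_term_eq_zero (r := 0) (r' := (k.Q m).natDegree + 1)]
    · rfl
    · simp [poly]
    · simp
    · intro b hb
      rw [hf (Sum.inr (Sum.inl m)) b hb, map_zero]
  · rw [hankel_term_eq_zero (r' := 0) (r := (k.Q m).natDegree + 1)]
    · rfl
    · simp [poly]
    · exact hf (Sum.inr (Sum.inl m))
    · simp

theorem re_inner_nonpos (hV : IsHankelIntegralOperator V k.kernel) {f : L2Plus}
    (hf : ∀ i, ∀ a < k.posCut i, ⟪expVec (k.exponent i) a, f⟫_ℂ = 0) :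
    (⟪f, V f⟫_ℂ).re ≤ 0 := by
  rw [kernel_eq] at hV
  rw [inner_hankel_apply k.exponent_conjIndex k.exponent_re_pos hV, Complex.re_sum]
  refine Finset.sum_nonpos fun i _ => ?_
  simp only [← inner_conj_symm f (expVec _ _)]
  rcases i with m | m | m
  · exact re_hankel_term_nonpos _ (hf (Sum.inl m))
  · rw [hankel_term_eq_zero (r := 0) (r' := (k.Q m).natDegree + 1)]
    · rfl
    · simp [poly]
    · simp
    · intro b hb
      rw [hf (Sum.inr (Sum.inl m)) b hb, map_zero]
  · rw [hankel_term_eq_zero (r' := 0) (r := (k.Q m).natDegree + 1)]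
    · rfl
    · simp [poly]
    · exact hf (Sum.inr (Sum.inl m))
    · simp

theorem Nminus_add_le (hV : IsHankelIntegralOperator V k.kernel) {A : L2Plus →L[ℂ] L2Plus}
    (hA : IsSelfAdjoint A) (hpos : ∀ f, 0 ≤ (⟪f, A f⟫_ℂ).re) : Nminus (A + V) ≤ k.totalNeg := by
  have h := Nminus_le_card (hA.add (k.isSelfAdjoint hV))
    (fun p : Σ i, Fin (k.negCut i) => expVec (k.exponent p.1) p.2) fun f hf => by
      rw [add_apply, inner_add_right, Complex.add_re]
      exact add_nonneg (hpos f) (k.re_inner_nonneg hV fun i a ha => hf ⟨i, ⟨a, ha⟩⟩)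
  rwa [Fintype.card_sigma, Finset.sum_congr rfl fun i _ => Fintype.card_fin _, sum_negCut] at h

/-- The upper bounds for `V` and `-V` add up to a lower bound for the rank, and the rank is at most
`N₋(V) + N₋(-V)`; so there is no slack in either. The cancellation in `ℕ∞` uses that the bound for
`-V` is finite. -/
theorem Nminus_eq (hV : IsHankelIntegralOperator V k.kernel) : Nminus V = k.totalNeg := by
  have hsa := k.isSelfAdjoint hV
  have h1 : Nminus V ≤ k.totalNeg := by
    simpa using k.Nminus_add_le hV (IsSelfAdjoint.zero _) (by simp)
  have h2 : Nminus (-V) ≤ ((∑ i, k.posCut i : ℕ) : ℕ∞) := by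
    have h := Nminus_le_card hsa.neg
      (fun p : Σ i, Fin (k.posCut i) => expVec (k.exponent p.1) p.2) fun f hf => by
        rw [neg_apply, inner_neg_right, Complex.neg_re, neg_nonneg]
        exact k.re_inner_nonpos hV fun i a ha => hf ⟨i, ⟨a, ha⟩⟩
    rwa [Fintype.card_sigma, Finset.sum_congr rfl fun i _ => Fintype.card_fin _] at h
  have hV' := hV
  rw [kernel_eq] at hV'
  have h3 := (sum_le_rank_hankel k.conjIndex_involutive k.exponent_conjIndex k.poly_ne_zero
    k.poly_conjIndex k.exponent_re_pos k.exponent_injective hV').trans (rank_le_Nminus_add hsa)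
  rw [← sum_negCut_add_sum_posCut, sum_negCut, Nat.cast_add] at h3
  refine le_antisymm h1 ?_
  have h4 := h3.trans (add_le_add_right h2 _)
  exact (ENat.add_le_add_iff_right (ENat.natCast_ne_top _)).1 h4

/-- The linear span of the functions `t ^ a e^{-βt}` that make up the range of the operator. -/
noncomputable def rangeSpan : Submodule ℂ L2Plus :=
  Submodule.span ℂ (Set.range fun p : Σ i, Fin ((k.poly i).natDegree + 1) =>
    expVec (k.exponent p.1) p.2)

instance : FiniteDimensional ℂ k.rangeSpan :=
  FiniteDimensional.span_of_finite ℂ (Set.finite_range _)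

theorem expVec_mem_rangeSpan (i) {a : ℕ} (ha : a < (k.poly i).natDegree + 1) :
    expVec (k.exponent i) a ∈ k.rangeSpan :=
  Submodule.subset_span ⟨⟨i, ⟨a, ha⟩⟩, rfl⟩

theorem apply_mem_rangeSpan (hV : IsHankelIntegralOperator V k.kernel) (f : L2Plus) :
    V f ∈ k.rangeSpan := by
  rw [kernel_eq] at hV
  rw [hankel_apply k.exponent_re_pos hV]
  exact Submodule.sum_mem _ fun i _ => Submodule.sum_mem _ fun a _ => Submodule.sum_mem _
    fun b hb => Submodule.smul_mem _ _ (k.expVec_mem_rangeSpan i (Finset.mem_range.1 hb))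

end FiniteRankKernel

/-! ### The Laplace transform on `L²(ℝ₊)` -/

open scoped ENNReal

/-- The Laplace transform of a function on `ℝ₊`. -/
noncomputable def laplaceFun (f : ℝ → ℂ) (t : ℝ) : ℂ :=
  ∫ s in Set.Ioi (0 : ℝ), Complex.exp (-(t * s : ℝ)) * f s

theorem lintegral_exp_mul_rpow_neg_half {t : ℝ} (ht : 0 < t) :
    ∫⁻ s in Set.Ioi (0 : ℝ), ENNReal.ofReal (s ^ (-(1 / 2) : ℝ) * Real.exp (-(t * s))) =
      ENNReal.ofReal (Real.sqrt Real.pi * t ^ (-(1 / 2) : ℝ)) := by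
  have hInt : IntegrableOn (fun s : ℝ => s ^ (-(1 / 2) : ℝ) * Real.exp (-(t * s)))
      (Set.Ioi 0) := by
    have := integrableOn_rpow_mul_exp_neg_mul_rpow (s := (-(1 / 2) : ℝ)) (p := 1) (b := t)
      (by norm_num) one_pos ht
    simpa using this
  rw [← ofReal_integral_eq_lintegral_ofReal hInt]
  · congr 1
    have h := Real.integral_rpow_mul_exp_neg_mul_Ioi (a := 1 / 2) (by norm_num) ht
    rw [Real.Gamma_one_half_eq, one_div t, Real.inv_rpow ht.le, ← Real.rpow_neg ht.le] at h
    rw [mul_comm (Real.sqrt _), ← h]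
    norm_num
  · filter_upwards [ae_restrict_mem measurableSet_Ioi] with s hs
    have : (0 : ℝ) < s := hs
    simp only [Pi.zero_apply]
    positivity

/-- Schur's test for the kernel `e^{-ts}`. -/
theorem lintegral_laplace_sq_le {φ : ℝ → ℝ≥0∞}
    (hφ : AEMeasurable φ (volume.restrict (Set.Ioi (0 : ℝ)))) :
    ∫⁻ t in Set.Ioi (0 : ℝ), (∫⁻ s in Set.Ioi (0 : ℝ),
      ENNReal.ofReal (Real.exp (-(t * s))) * φ s) ^ (2 : ℝ) ≤
      ENNReal.ofReal Real.pi * ∫⁻ s in Set.Ioi (0 : ℝ), φ s ^ (2 : ℝ) := by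
  have hpt : ∀ t ∈ Set.Ioi (0 : ℝ), (∫⁻ s in Set.Ioi (0 : ℝ),
      ENNReal.ofReal (Real.exp (-(t * s))) * φ s) ^ (2 : ℝ) ≤
      ENNReal.ofReal (Real.sqrt Real.pi * t ^ (-(1 / 2) : ℝ)) * ∫⁻ s in Set.Ioi (0 : ℝ),
        ENNReal.ofReal (Real.exp (-(t * s)) * s ^ (1 / 2 : ℝ)) * φ s ^ (2 : ℝ) := by
    intro t ht
    -- Cauchy–Schwarz after splitting `e^{-ts}` into two halves weighted by `s^{-1/4}` and
    -- `s^{1/4}`. The square of the first integrates to `√π t^{-1/2}`; the later integral in `t`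
    -- yields `√π s^{-1/2}`, which cancels the remaining `s^{1/2}`.
    have h := ENNReal.lintegral_mul_le_Lp_mul_Lq (volume.restrict (Set.Ioi (0 : ℝ)))
      (p := 2) (q := 2) Real.HolderConjugate.two_two
      (f := fun s => ENNReal.ofReal (s ^ (-(1 / 4) : ℝ) * Real.exp (-(t * s / 2))))
      (g := fun s => ENNReal.ofReal (Real.exp (-(t * s / 2)) * s ^ (1 / 4 : ℝ)) * φ s)
      (by fun_prop) (AEMeasurable.mul (by fun_prop) hφ)
    have h2 := ENNReal.rpow_le_rpow h (z := 2) (by norm_num)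
    rw [ENNReal.mul_rpow_of_nonneg _ _ (by norm_num), ← ENNReal.rpow_mul, ← ENNReal.rpow_mul]
      at h2
    norm_num only [ENNReal.rpow_one] at h2
    rw [← lintegral_exp_mul_rpow_neg_half ht]
    refine le_trans (le_of_eq ?_) (h2.trans (le_of_eq ?_))
    · congr 1
      refine setLIntegral_congr_fun measurableSet_Ioi fun s hs => ?_
      have hs' : (0 : ℝ) < s := hs
      simp only [Pi.mul_apply]
      rw [← mul_assoc, ← ENNReal.ofReal_mul (by positivity)]
      congr 2
      have : s ^ (-(1 / 4) : ℝ) * s ^ (1 / 4 : ℝ) = 1 := by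
        rw [← Real.rpow_add hs']; norm_num
      calc Real.exp (-(t * s)) = Real.exp (-(t * s / 2)) * Real.exp (-(t * s / 2)) := by
            rw [← Real.exp_add]; congr 1; ring
        _ = (s ^ (-(1 / 4) : ℝ) * s ^ (1 / 4 : ℝ)) *
            (Real.exp (-(t * s / 2)) * Real.exp (-(t * s / 2))) := by rw [this, one_mul]
        _ = _ := by norm_num only; ring
    · congr 1
      · refine setLIntegral_congr_fun measurableSet_Ioi fun s hs => ?_
        have hs' : (0 : ℝ) < s := hs
        rw [ENNReal.ofReal_rpow_of_nonneg (by positivity) (by norm_num),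
          Real.mul_rpow (by positivity) (by positivity), ← Real.rpow_mul hs'.le,
          ← Real.exp_mul]
        congr 3
        · norm_num
        · ring
      · refine setLIntegral_congr_fun measurableSet_Ioi fun s hs => ?_
        have hs' : (0 : ℝ) < s := hs
        rw [ENNReal.mul_rpow_of_nonneg _ _ (by norm_num),
          ENNReal.ofReal_rpow_of_nonneg (by positivity) (by norm_num),
          Real.mul_rpow (by positivity) (by positivity), ← Real.rpow_mul hs'.le,
          ← Real.exp_mul]
        congr 4
        · ring
        · norm_num
  calc _ ≤ ∫⁻ t in Set.Ioi (0 : ℝ), ∫⁻ s in Set.Ioi (0 : ℝ),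
        ENNReal.ofReal (Real.sqrt Real.pi * t ^ (-(1 / 2) : ℝ)) *
        (ENNReal.ofReal (Real.exp (-(t * s)) * s ^ (1 / 2 : ℝ)) * φ s ^ (2 : ℝ)) := by
        refine setLIntegral_mono' measurableSet_Ioi fun t ht => (hpt t ht).trans (le_of_eq ?_)
        rw [lintegral_const_mul'' _ (by fun_prop)]
    _ = ∫⁻ s in Set.Ioi (0 : ℝ), ∫⁻ t in Set.Ioi (0 : ℝ),
        ENNReal.ofReal (Real.sqrt Real.pi * t ^ (-(1 / 2) : ℝ)) *
        (ENNReal.ofReal (Real.exp (-(t * s)) * s ^ (1 / 2 : ℝ)) * φ s ^ (2 : ℝ)) := by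
        refine lintegral_lintegral_swap ?_
        refine AEMeasurable.mul (by fun_prop) (AEMeasurable.mul (by fun_prop) ?_)
        exact (hφ.comp_snd (μ := volume.restrict (Set.Ioi (0 : ℝ)))).pow_const _
    _ = ∫⁻ s in Set.Ioi (0 : ℝ), ENNReal.ofReal Real.pi * φ s ^ (2 : ℝ) := by
        refine setLIntegral_congr_fun measurableSet_Ioi fun s hs => ?_
        have hs' : (0 : ℝ) < s := hs
        have h1 : ∀ t ∈ Set.Ioi (0 : ℝ), ENNReal.ofReal (Real.sqrt Real.pi * t ^ (-(1 / 2) : ℝ)) *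
            (ENNReal.ofReal (Real.exp (-(t * s)) * s ^ (1 / 2 : ℝ)) * φ s ^ (2 : ℝ)) =
            ENNReal.ofReal (Real.sqrt Real.pi * s ^ (1 / 2 : ℝ)) * φ s ^ (2 : ℝ) *
              ENNReal.ofReal (t ^ (-(1 / 2) : ℝ) * Real.exp (-(s * t))) := fun t ht => by
          have ht' : (0 : ℝ) < t := ht
          rw [← mul_assoc, ← ENNReal.ofReal_mul (by positivity), mul_right_comm _ (φ s ^ (2 : ℝ)),
            ← ENNReal.ofReal_mul (by positivity), mul_comm s t]
          congr 2
          ring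
        rw [setLIntegral_congr_fun measurableSet_Ioi h1, lintegral_const_mul _ (by fun_prop),
          lintegral_exp_mul_rpow_neg_half hs', mul_right_comm, ← ENNReal.ofReal_mul (by positivity)]
        congr 2
        have h2 : s ^ (1 / 2 : ℝ) * s ^ (-(1 / 2) : ℝ) = 1 := by
          rw [← Real.rpow_add hs']; norm_num
        calc _ = (Real.sqrt Real.pi * Real.sqrt Real.pi) *
              (s ^ (1 / 2 : ℝ) * s ^ (-(1 / 2) : ℝ)) := by ring
          _ = Real.pi := by rw [h2, Real.mul_self_sqrt Real.pi_pos.le, mul_one]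
    _ = _ := lintegral_const_mul'' _ (by fun_prop)

theorem aestronglyMeasurable_laplaceFun {f : ℝ → ℂ}
    (hf : AEStronglyMeasurable f (volume.restrict (Set.Ioi (0 : ℝ)))) :
    AEStronglyMeasurable (laplaceFun f) (volume.restrict (Set.Ioi (0 : ℝ))) := by
  refine AEStronglyMeasurable.integral_prod_right'
    (f := fun p : ℝ × ℝ => Complex.exp (-(p.1 * p.2 : ℝ)) * f p.2) ?_
  refine AEStronglyMeasurable.mul ?_ hf.comp_snd
  exact (by fun_prop : Continuous fun p : ℝ × ℝ =>
    Complex.exp (-(p.1 * p.2 : ℝ))).aestronglyMeasurable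

theorem enorm_exp_neg_ofReal (x : ℝ) :
    ‖Complex.exp (-(x : ℂ))‖ₑ = ENNReal.ofReal (Real.exp (-x)) := by
  rw [← Complex.ofReal_neg, ← Complex.ofReal_exp, ← ofReal_norm, Complex.norm_real,
    Real.norm_of_nonneg (Real.exp_pos _).le]

theorem enorm_laplaceFun_le (f : ℝ → ℂ) (t : ℝ) :
    ‖laplaceFun f t‖ₑ ≤
      ∫⁻ s in Set.Ioi (0 : ℝ), ENNReal.ofReal (Real.exp (-(t * s))) * ‖f s‖ₑ := by
  refine (enorm_integral_le_lintegral_enorm _).trans (le_of_eq ?_)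
  refine lintegral_congr fun s => ?_
  rw [enorm_mul, enorm_exp_neg_ofReal]

theorem eLpNorm_laplaceFun_le {f : ℝ → ℂ}
    (hf : AEStronglyMeasurable f (volume.restrict (Set.Ioi (0 : ℝ)))) :
    eLpNorm (laplaceFun f) 2 (volume.restrict (Set.Ioi (0 : ℝ))) ≤
      ENNReal.ofReal Real.pi ^ (1 / 2 : ℝ) * eLpNorm f 2 (volume.restrict (Set.Ioi (0 : ℝ))) := by
  rw [eLpNorm_eq_lintegral_rpow_enorm_toReal (by norm_num) (by norm_num),
    eLpNorm_eq_lintegral_rpow_enorm_toReal (by norm_num) (by norm_num)]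
  simp only [ENNReal.toReal_ofNat]
  rw [← ENNReal.mul_rpow_of_nonneg _ _ (by norm_num)]
  refine ENNReal.rpow_le_rpow ?_ (by norm_num)
  refine le_trans (lintegral_mono fun t => ?_) (lintegral_laplace_sq_le hf.enorm)
  exact ENNReal.rpow_le_rpow (enorm_laplaceFun_le f t) (by norm_num)

theorem memLp_laplaceFun (f : L2Plus) :
    MemLp (laplaceFun f) 2 (volume.restrict (Set.Ioi (0 : ℝ))) :=
  ⟨aestronglyMeasurable_laplaceFun (Lp.aestronglyMeasurable f),
    (eLpNorm_laplaceFun_le (Lp.aestronglyMeasurable f)).trans_lt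
      (ENNReal.mul_lt_top (ENNReal.rpow_lt_top_of_nonneg (by norm_num) ENNReal.ofReal_ne_top)
        (Lp.memLp f).2)⟩

theorem laplaceFun_eq_inner (f : L2Plus) {t : ℝ} (ht : 0 < t) :
    laplaceFun f t = ⟪expVec t 0, f⟫_ℂ := by
  have h := inner_expVec_conj (β := (t : ℂ)) (by simpa using ht) 0 f
  rw [Complex.conj_ofReal] at h
  rw [h, laplaceFun]
  simp

/-- The Laplace transform as a bounded operator on `L²(ℝ₊)`. -/
noncomputable def laplace : L2Plus →L[ℂ] L2Plus :=
  LinearMap.mkContinuous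
    { toFun := fun f => (memLp_laplaceFun f).toLp _
      map_add' := fun f g => by
        rw [← MemLp.toLp_add, MemLp.toLp_eq_toLp_iff]
        filter_upwards [ae_restrict_mem measurableSet_Ioi] with t ht
        simp only [Pi.add_apply, laplaceFun_eq_inner _ ht, inner_add_right]
      map_smul' := fun c f => by
        rw [RingHom.id_apply, ← MemLp.toLp_const_smul, MemLp.toLp_eq_toLp_iff]
        filter_upwards [ae_restrict_mem measurableSet_Ioi] with t ht
        simp only [Pi.smul_apply, laplaceFun_eq_inner _ ht, inner_smul_right, smul_eq_mul] }
    (ENNReal.ofReal Real.pi ^ (1 / 2 : ℝ)).toReal fun f => by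
      simp only [LinearMap.coe_mk, AddHom.coe_mk]
      rw [Lp.norm_toLp, Lp.norm_def, ← ENNReal.toReal_mul]
      exact ENNReal.toReal_mono (ENNReal.mul_lt_top
        (ENNReal.rpow_lt_top_of_nonneg (by norm_num) ENNReal.ofReal_ne_top) (Lp.memLp f).2).ne
        (eLpNorm_laplaceFun_le (Lp.aestronglyMeasurable f))

theorem coeFn_laplace (f : L2Plus) :
    laplace f =ᵐ[volume.restrict (Set.Ioi (0 : ℝ))] laplaceFun f :=
  MemLp.coeFn_toLp (memLp_laplaceFun f)

/-- Hölder's inequality and the Schur bound applied to absolute values; this licenses Fubini in the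
proof that the Laplace transform is self-adjoint. -/
theorem integrable_laplace_kernel (f g : L2Plus) :
    Integrable (Function.uncurry fun t s : ℝ =>
      (starRingEnd ℂ) (g t) * (Complex.exp (-(t * s : ℝ)) * f s))
      ((volume.restrict (Set.Ioi (0 : ℝ))).prod (volume.restrict (Set.Ioi (0 : ℝ)))) := by
  have hf := Lp.aestronglyMeasurable f
  have hg := Lp.aestronglyMeasurable g
  have hm : AEStronglyMeasurable (Function.uncurry fun t s : ℝ =>
      (starRingEnd ℂ) (g t) * (Complex.exp (-(t * s : ℝ)) * f s))
      ((volume.restrict (Set.Ioi (0 : ℝ))).prod (volume.restrict (Set.Ioi (0 : ℝ)))) := by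
    refine AEStronglyMeasurable.mul
      (Complex.continuous_conj.comp_aestronglyMeasurable hg.comp_fst) ?_
    refine AEStronglyMeasurable.mul ?_ hf.comp_snd
    exact (by fun_prop : Continuous fun p : ℝ × ℝ =>
      Complex.exp (-(p.1 * p.2 : ℝ))).aestronglyMeasurable
  refine ⟨hm, ?_⟩
  rw [HasFiniteIntegral, lintegral_prod _ hm.enorm]
  have h1 : ∀ t : ℝ, ∫⁻ s in Set.Ioi (0 : ℝ), ‖Function.uncurry (fun t s : ℝ =>
      (starRingEnd ℂ) (g t) * (Complex.exp (-(t * s : ℝ)) * f s)) (t, s)‖ₑ =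
      ‖g t‖ₑ * ∫⁻ s in Set.Ioi (0 : ℝ), ENNReal.ofReal (Real.exp (-(t * s))) * ‖f s‖ₑ := by
    intro t
    have hm' : AEMeasurable (fun s => ENNReal.ofReal (Real.exp (-(t * s))) * ‖f s‖ₑ)
        (volume.restrict (Set.Ioi (0 : ℝ))) := AEMeasurable.mul (by fun_prop) hf.enorm
    rw [← lintegral_const_mul'' _ hm']
    refine lintegral_congr fun s => ?_
    simp only [Function.uncurry_apply_pair, enorm_mul, enorm_exp_neg_ofReal, RCLike.enorm_conj]
  simp only [h1]
  have hm2 : AEMeasurable (fun t => ∫⁻ s in Set.Ioi (0 : ℝ),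
      ENNReal.ofReal (Real.exp (-(t * s))) * ‖f s‖ₑ) (volume.restrict (Set.Ioi (0 : ℝ))) := by
    refine AEMeasurable.lintegral_prod_right'
      (f := fun p : ℝ × ℝ => ENNReal.ofReal (Real.exp (-(p.1 * p.2))) * ‖f p.2‖ₑ) ?_
    exact AEMeasurable.mul (by fun_prop) hf.enorm.comp_snd
  refine (ENNReal.lintegral_mul_le_Lp_mul_Lq _ Real.HolderConjugate.two_two hg.enorm hm2).trans_lt
    (ENNReal.mul_lt_top ?_ ?_)
  · have := (Lp.memLp g).2
    rw [eLpNorm_eq_lintegral_rpow_enorm_toReal (by norm_num) (by norm_num)] at this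
    simpa only [ENNReal.toReal_ofNat] using this
  · have := (Lp.memLp f).2
    rw [eLpNorm_eq_lintegral_rpow_enorm_toReal (by norm_num) (by norm_num)] at this
    simp only [ENNReal.toReal_ofNat] at this
    refine ENNReal.rpow_lt_top_of_nonneg (by norm_num) ?_
    refine ((lintegral_laplace_sq_le hf.enorm).trans_lt (ENNReal.mul_lt_top (by simp) ?_)).ne
    rwa [ENNReal.rpow_lt_top_iff_of_pos (by norm_num)] at this

theorem isSelfAdjoint_laplace : IsSelfAdjoint laplace := by
  rw [ContinuousLinearMap.isSelfAdjoint_iff_isSymmetric]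
  intro g f
  simp only [ContinuousLinearMap.coe_coe]
  have h1 : ⟪g, laplace f⟫_ℂ = ∫ t in Set.Ioi (0 : ℝ), ∫ s in Set.Ioi (0 : ℝ),
      (starRingEnd ℂ) (g t) * (Complex.exp (-(t * s : ℝ)) * f s) := by
    rw [L2.inner_def]
    refine integral_congr_ae ?_
    filter_upwards [coeFn_laplace f] with t ht
    rw [ht, RCLike.inner_apply', laplaceFun, integral_const_mul]
  have h2 : ⟪laplace g, f⟫_ℂ = ∫ s in Set.Ioi (0 : ℝ), ∫ t in Set.Ioi (0 : ℝ),
      (starRingEnd ℂ) (g t) * (Complex.exp (-(t * s : ℝ)) * f s) := by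
    rw [L2.inner_def]
    refine integral_congr_ae ?_
    filter_upwards [coeFn_laplace g] with s hs
    rw [hs, RCLike.inner_apply', laplaceFun, ← integral_conj, ← integral_mul_const]
    refine integral_congr_ae (ae_of_all _ fun t => ?_)
    simp only [map_mul, ← Complex.exp_conj, map_neg, Complex.conj_ofReal, mul_comm s t]
    ring
  rw [h1, h2, integral_integral_swap (integrable_laplace_kernel f g)]

theorem memLp_exp_neg_mul (f : L2Plus) :
    MemLp (fun s : ℝ => Complex.exp (-(s : ℂ)) * f s) 2 (volume.restrict (Set.Ioi (0 : ℝ))) := by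
  refine MemLp.of_le (Lp.memLp f) (AEStronglyMeasurable.mul
    (by fun_prop : Continuous fun s : ℝ => Complex.exp (-(s : ℂ))).aestronglyMeasurable
    (Lp.aestronglyMeasurable f)) ?_
  filter_upwards [ae_restrict_mem measurableSet_Ioi] with s hs
  have hs' : (0 : ℝ) < s := hs
  rw [norm_mul, Complex.norm_exp]
  refine mul_le_of_le_one_left (norm_nonneg _) ?_
  simpa using hs'.le

/-- Multiplication by `e^{-s}` on `L²(ℝ₊)`. -/
noncomputable def mulExpNeg : L2Plus →ₗ[ℂ] L2Plus where
  toFun f := (memLp_exp_neg_mul f).toLp _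
  map_add' f g := by
    rw [← MemLp.toLp_add, MemLp.toLp_eq_toLp_iff]
    filter_upwards [Lp.coeFn_add f g] with s hs
    simp only [hs, Pi.add_apply, mul_add]
  map_smul' c f := by
    rw [RingHom.id_apply, ← MemLp.toLp_const_smul, MemLp.toLp_eq_toLp_iff]
    filter_upwards [Lp.coeFn_smul c f] with s hs
    simp only [hs, Pi.smul_apply, smul_eq_mul]
    ring

theorem coeFn_mulExpNeg (f : L2Plus) :
    mulExpNeg f =ᵐ[volume.restrict (Set.Ioi (0 : ℝ))] fun s : ℝ => Complex.exp (-(s : ℂ)) * f s :=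
  MemLp.coeFn_toLp (memLp_exp_neg_mul f)

/-- `e^{-s}` is injective, so it equals `c` at no more than one point, a null set; elsewhere `f`
must vanish. -/
theorem mulExpNeg_eq_smul {f : L2Plus} {c : ℂ} (h : mulExpNeg f = c • f) : f = 0 := by
  refine Lp.ext ?_
  have hne : ∀ᵐ s : ℝ ∂(volume.restrict (Set.Ioi (0 : ℝ))), Complex.exp (-(s : ℂ)) ≠ c := by
    refine ae_restrict_of_ae (Set.Subsingleton.measure_zero ?_ volume)
    intro x hx y hy
    simp only [Set.mem_compl_iff, Set.mem_ofPred_eq, not_not] at hx hy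
    have h1 := hx.trans hy.symm
    rw [← Complex.ofReal_neg, ← Complex.ofReal_neg, ← Complex.ofReal_exp, ← Complex.ofReal_exp,
      Complex.ofReal_inj, Real.exp_eq_exp] at h1
    linarith
  have h1 := coeFn_mulExpNeg f
  rw [h] at h1
  filter_upwards [hne, h1, Lp.coeFn_smul c f, Lp.coeFn_zero ℂ 2 (volume.restrict (Set.Ioi (0 : ℝ)))]
    with s h2 h3 h4 h5
  rw [h5, Pi.zero_apply]
  rw [h4, Pi.smul_apply, smul_eq_mul, ← sub_eq_zero, ← sub_mul] at h3
  exact (mul_eq_zero.1 h3).resolve_left (sub_ne_zero.2 h2.symm)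

theorem ae_comp_add_one {p : ℝ → Prop} (h : ∀ᵐ t ∂(volume.restrict (Set.Ioi (0 : ℝ))), p t) :
    ∀ᵐ t ∂(volume.restrict (Set.Ioi (0 : ℝ))), p (t + 1) := by
  rw [ae_restrict_iff' measurableSet_Ioi] at h ⊢
  have := (measurePreserving_add_right (volume : Measure ℝ) 1).quasiMeasurePreserving.ae h
  filter_upwards [this] with t ht ht0
  have ht1 : (0 : ℝ) < t := ht0
  exact ht (Set.mem_Ioi.2 (by linarith))

theorem laplace_mulExpNeg (f : L2Plus) :
    laplace (mulExpNeg f) =ᵐ[volume.restrict (Set.Ioi (0 : ℝ))] fun t => laplace f (t + 1) := by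
  filter_upwards [coeFn_laplace (mulExpNeg f), ae_comp_add_one (coeFn_laplace f)] with t h1 h2
  rw [h1, h2, laplaceFun, laplaceFun]
  refine integral_congr_ae ?_
  filter_upwards [coeFn_mulExpNeg f] with s hs
  rw [hs, ← mul_assoc, ← Complex.exp_add]
  congr 2
  push_cast
  ring

/-- The binomial expansion of `(t + 1)^j` involves only powers up to `j`, so the span is
shift-invariant. -/
theorem exists_expVec_comp_add_one {β : ℂ} (hβ : 0 < β.re) (j : ℕ) (F : Submodule ℂ L2Plus)
    (hF : ∀ a ≤ j, expVec β a ∈ F) :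
    ∃ u ∈ F, u =ᵐ[volume.restrict (Set.Ioi (0 : ℝ))] fun t => expVec β j (t + 1) := by
  refine ⟨∑ a ∈ Finset.range (j + 1), (Complex.exp (-β) * (j.choose a : ℂ)) • expVec β a,
    Submodule.sum_mem _ fun a ha => Submodule.smul_mem _ _
      (hF a (Nat.lt_succ_iff.1 (Finset.mem_range.1 ha))), ?_⟩
  have h1 := ae_all_iff.2 fun a => coeFn_expVec hβ a
  have h2 := ae_all_iff.2 fun a =>
    Lp.coeFn_smul (Complex.exp (-β) * (j.choose a : ℂ)) (expVec β a)
  filter_upwards [h1, h2, ae_comp_add_one (coeFn_expVec hβ j), coeFn_finsetSum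
    (Finset.range (j + 1)) fun a => (Complex.exp (-β) * (j.choose a : ℂ)) • expVec β a]
    with t h1 h2 h3 h4
  rw [h4, h3]
  push_cast
  rw [add_pow, Finset.sum_mul]
  refine Finset.sum_congr rfl fun a _ => ?_
  rw [h2, Pi.smul_apply, h1, smul_eq_mul, mul_add, neg_add, Complex.exp_add]
  simp
  ring

theorem FiniteRankKernel.exists_comp_add_one (k : FiniteRankKernel) {f : L2Plus}
    (hf : f ∈ k.rangeSpan) :
    ∃ u ∈ k.rangeSpan, u =ᵐ[volume.restrict (Set.Ioi (0 : ℝ))] fun t => f (t + 1) := by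
  induction hf using Submodule.span_induction with
  | mem f hf =>
    obtain ⟨p, rfl⟩ := hf
    exact exists_expVec_comp_add_one (k.exponent_re_pos _) _ _ fun a ha =>
      k.expVec_mem_rangeSpan p.1 (ha.trans_lt p.2.2)
  | zero =>
    have h0 := Lp.coeFn_zero ℂ 2 (volume.restrict (Set.Ioi (0 : ℝ)))
    refine ⟨0, Submodule.zero_mem _, ?_⟩
    filter_upwards [h0, ae_comp_add_one h0] with t h1 h2
    rw [h1, h2, Pi.zero_apply, Pi.zero_apply]
  | add x y _ _ hx hy =>
    obtain ⟨u, hu, hux⟩ := hx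
    obtain ⟨v, hv, hvy⟩ := hy
    refine ⟨u + v, Submodule.add_mem _ hu hv, ?_⟩
    filter_upwards [hux, hvy, Lp.coeFn_add u v, ae_comp_add_one (Lp.coeFn_add x y)]
      with t h1 h2 h3 h4
    rw [h3, h4, Pi.add_apply, Pi.add_apply, h1, h2]
  | smul c x _ hx =>
    obtain ⟨u, hu, hux⟩ := hx
    refine ⟨c • u, Submodule.smul_mem _ c hu, ?_⟩
    filter_upwards [hux, Lp.coeFn_smul c u, ae_comp_add_one (Lp.coeFn_smul c x)] with t h1 h3 h4
    rw [h3, h4, Pi.smul_apply, Pi.smul_apply, h1]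

/-- The range of an injective Laplace transform contains no exponential polynomials. -/
theorem FiniteRankKernel.eq_zero_of_laplace_mem (k : FiniteRankKernel)
    (hinj : Function.Injective laplace) {g : L2Plus} (hg : laplace g ∈ k.rangeSpan) : g = 0 := by
  -- The preimage is finite dimensional by injectivity and stable under multiplication by `e^{-s}`.
  -- Were it non-zero, that operator would have an eigenvector in it.
  let W : Submodule ℂ L2Plus := k.rangeSpan.comap (laplace : L2Plus →ₗ[ℂ] L2Plus)
  have hW : ∀ f ∈ W, mulExpNeg f ∈ W := fun f hf => by
    obtain ⟨u, hu, huf⟩ := k.exists_comp_add_one (f := laplace f) hf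
    have : laplace (mulExpNeg f) = u := Lp.ext ((laplace_mulExpNeg f).trans huf.symm)
    change laplace (mulExpNeg f) ∈ k.rangeSpan
    rwa [this]
  have : FiniteDimensional ℂ W := by
    let J : W →ₗ[ℂ] k.rangeSpan :=
      ((laplace : L2Plus →ₗ[ℂ] L2Plus) ∘ₗ W.subtype).codRestrict _ fun f => f.2
    exact FiniteDimensional.of_injective J fun x y h =>
      Subtype.ext (hinj (congrArg Subtype.val h))
  by_contra h0
  have : Nontrivial W := ⟨⟨⟨g, hg⟩, 0, fun h => h0 (congrArg Subtype.val h)⟩⟩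
  obtain ⟨c, hc⟩ := Module.End.exists_eigenvalue (mulExpNeg.restrict hW)
  obtain ⟨w, hw⟩ := hc.exists_hasEigenvector
  refine hw.2 (Subtype.ext (mulExpNeg_eq_smul (c := c) ?_))
  exact congrArg Subtype.val hw.apply_eq_smul

/-! ### The inverse Fourier transform of test functions -/

open scoped FourierTransform ENNReal

/-- The constant `(2π)^{-1/2}`. -/
noncomputable def phiConst : ℝ := (2 * Real.pi) ^ (-(1 / 2) : ℝ)

theorem phiConst_mul_sqrt : phiConst * Real.sqrt (2 * Real.pi) = 1 := by
  have h : (0 : ℝ) < 2 * Real.pi := by positivity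
  rw [phiConst, Real.sqrt_eq_rpow, ← Real.rpow_add h]
  norm_num

theorem phiConst_eq : phiConst = Real.sqrt (2 * Real.pi) * (2 * Real.pi)⁻¹ := by
  have h : (0 : ℝ) < 2 * Real.pi := by positivity
  rw [phiConst, Real.sqrt_eq_rpow, ← Real.rpow_neg_one, ← Real.rpow_add h]
  norm_num

/-- The entire extension `z ↦ (2π)^{-1/2} ∫ g(ξ) e^{izξ} dξ` of the inverse Fourier transform. -/
noncomputable def invPhi (g : ℝ → ℂ) (z : ℂ) : ℂ :=
  (phiConst : ℂ) * ∫ ξ : ℝ, g ξ * Complex.exp (Complex.I * z * ξ)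

theorem norm_exp_I_mul (z : ℂ) (ξ : ℝ) :
    ‖Complex.exp (Complex.I * z * ξ)‖ = Real.exp (-(z.im * ξ)) := by
  rw [Complex.norm_exp]
  simp

theorem integrable_mul_of_hasCompactSupport {g h : ℝ → ℂ} (hg : Continuous g)
    (hgc : HasCompactSupport g) (hh : Continuous h) : Integrable fun ξ => g ξ * h ξ :=
  (hg.mul hh).integrable_of_hasCompactSupport hgc.mul_right

theorem differentiable_invPhi {g : ℝ → ℂ} (hg : Continuous g) (hgc : HasCompactSupport g) :
    Differentiable ℂ (invPhi g) := by
  intro z₀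
  refine DifferentiableAt.const_mul ?_ _
  -- A majorant of the `z`-derivative on the unit ball around `z₀`, where `|Im z| ≤ |Im z₀| + 1`.
  have hb : Integrable fun ξ : ℝ => ‖g ξ‖ * (|ξ| * Real.exp ((|z₀.im| + 1) * |ξ|)) :=
    Continuous.integrable_of_hasCompactSupport (by fun_prop) hgc.norm.mul_right
  refine (hasDerivAt_integral_of_dominated_loc_of_deriv_le (μ := volume)
    (F := fun z (ξ : ℝ) => g ξ * Complex.exp (Complex.I * z * ξ))
    (F' := fun z (ξ : ℝ) => g ξ * (Complex.exp (Complex.I * z * ξ) * (Complex.I * 1 * ξ)))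
    (Metric.ball_mem_nhds z₀ one_pos)
    (Filter.Eventually.of_forall fun z => Continuous.aestronglyMeasurable (by fun_prop))
    (integrable_mul_of_hasCompactSupport hg hgc (by fun_prop))
    (Continuous.aestronglyMeasurable (by fun_prop)) (ae_of_all _ fun ξ z hz => ?_) hb
    (ae_of_all _ fun ξ z _ => ?_)).2.differentiableAt
  · rw [norm_mul, norm_mul, norm_exp_I_mul, mul_comm (Real.exp _)]
    have h1 : ‖Complex.I * 1 * (ξ : ℂ)‖ = |ξ| := by simp
    rw [h1]
    gcongr
    have h2 : |z.im| ≤ |z₀.im| + 1 := by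
      have h3 : |z.im - z₀.im| ≤ ‖z - z₀‖ := by
        rw [← Complex.sub_im]
        exact Complex.abs_im_le_norm _
      have h4 : ‖z - z₀‖ < 1 := by simpa [dist_eq_norm] using hz
      have h5 := abs_sub_abs_le_abs_sub z.im z₀.im
      linarith
    calc -(z.im * ξ) ≤ |z.im * ξ| := neg_le_abs _
      _ = |z.im| * |ξ| := abs_mul _ _
      _ ≤ _ := by gcongr
  · exact ((((hasDerivAt_id z).const_mul Complex.I).mul_const (ξ : ℂ)).cexp).const_mul (g ξ)

theorem invPhi_deriv {g : ℝ → ℂ} (hg : ContDiff ℝ ∞ g) (hgc : HasCompactSupport g) (z : ℂ) :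
    invPhi (deriv g) z = -(Complex.I * z) * invPhi g z := by
  have hg' : Continuous (deriv g) := hg.continuous_deriv (by simp)
  have hexp : ∀ ξ : ℝ, HasDerivAt (fun ξ : ℝ => Complex.exp (Complex.I * z * ξ))
      (Complex.exp (Complex.I * z * ξ) * (Complex.I * z * 1)) ξ := fun ξ =>
    (((hasDerivAt_id (ξ : ℂ)).const_mul (Complex.I * z)).cexp).comp_ofReal
  have h := integral_mul_deriv_eq_deriv_mul_of_integrable
    (u := fun ξ : ℝ => Complex.exp (Complex.I * z * ξ)) (v := g)
    (fun ξ _ => hexp ξ) (fun ξ _ => (hg.differentiable (by simp) ξ).hasDerivAt)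
    (by
      have := integrable_mul_of_hasCompactSupport hg' hgc.deriv
        (h := fun ξ : ℝ => Complex.exp (Complex.I * z * ξ)) (by fun_prop)
      exact this.congr (ae_of_all _ fun ξ => mul_comm _ _))
    (by
      have := integrable_mul_of_hasCompactSupport hg.continuous hgc
        (h := fun ξ : ℝ => Complex.exp (Complex.I * z * ξ) * (Complex.I * z * 1)) (by fun_prop)
      exact this.congr (ae_of_all _ fun ξ => mul_comm _ _))
    (by
      have := integrable_mul_of_hasCompactSupport hg.continuous hgc
        (h := fun ξ : ℝ => Complex.exp (Complex.I * z * ξ)) (by fun_prop)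
      exact this.congr (ae_of_all _ fun ξ => mul_comm _ _))
  rw [invPhi, invPhi]
  have h1 : ∫ ξ : ℝ, deriv g ξ * Complex.exp (Complex.I * z * ξ) =
      ∫ ξ : ℝ, Complex.exp (Complex.I * z * ξ) * deriv g ξ := by simp only [mul_comm]
  have h2 : ∫ ξ : ℝ, Complex.exp (Complex.I * z * ξ) * (Complex.I * z * 1) * g ξ =
      Complex.I * z * ∫ ξ : ℝ, g ξ * Complex.exp (Complex.I * z * ξ) := by
    rw [← integral_const_mul]
    congr 1
    ext ξ
    ring
  rw [h1, h, h2]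
  ring

/-- The Paley–Wiener estimate: by `invPhi_deriv` a factor `|z|` is paid for by one derivative of
`g`, which does not enlarge the support, so the exponential type stays `r`. -/
theorem norm_invPhi_le {r : ℝ} (n : ℕ) : ∀ {g : ℝ → ℂ}, ContDiff ℝ ∞ g → HasCompactSupport g →
    (∀ ξ ∈ tsupport g, |ξ| ≤ r) →
    ∃ C : ℝ, ∀ z : ℂ, (1 + ‖z‖) ^ n * ‖invPhi g z‖ ≤ C * Real.exp (r * |z.im|) := by
  induction n with
  | zero =>
    intro g hg hgc hr
    refine ⟨‖(phiConst : ℂ)‖ * ∫ ξ, ‖g ξ‖, fun z => ?_⟩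
    rw [pow_zero, one_mul, invPhi, norm_mul, mul_assoc]
    refine mul_le_mul_of_nonneg_left ?_ (norm_nonneg _)
    rw [← integral_mul_const]
    refine norm_integral_le_of_norm_le
      ((hg.continuous.norm.integrable_of_hasCompactSupport hgc.norm).mul_const _)
      (ae_of_all _ fun ξ => ?_)
    rw [norm_mul, norm_exp_I_mul]
    by_cases hξ : ξ ∈ tsupport g
    · gcongr
      calc -(z.im * ξ) ≤ |z.im * ξ| := neg_le_abs _
        _ = |ξ| * |z.im| := by rw [abs_mul, mul_comm]
        _ ≤ _ := by gcongr; exact hr ξ hξ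
    · simp [image_eq_zero_of_notMem_tsupport hξ]
  | succ n ih =>
    intro g hg hgc hr
    obtain ⟨C, hC⟩ := ih hg hgc hr
    have hg' : ContDiff ℝ ∞ (deriv g) := by
      simpa using hg.iterate_deriv 1
    obtain ⟨D, hD⟩ := ih hg' hgc.deriv fun ξ hξ =>
      hr ξ (closure_minimal (support_deriv_subset) isClosed_closure hξ)
    refine ⟨C + D, fun z => ?_⟩
    have h1 : ‖invPhi (deriv g) z‖ = ‖z‖ * ‖invPhi g z‖ := by
      rw [invPhi_deriv hg hgc]
      simp
    calc (1 + ‖z‖) ^ (n + 1) * ‖invPhi g z‖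
        = (1 + ‖z‖) ^ n * ‖invPhi g z‖ + (1 + ‖z‖) ^ n * ‖invPhi (deriv g) z‖ := by
          rw [h1]; ring
      _ ≤ _ := by
          rw [add_mul]
          exact add_le_add (hC z) (hD z)

theorem exists_hasTypeBound_invPhi {g : ℝ → ℂ} (hg : ContDiff ℝ ∞ g) (hgc : HasCompactSupport g) :
    ∃ r > 0, HasTypeBound (invPhi g) r := by
  obtain ⟨r, hr⟩ := hgc.isCompact.isBounded.exists_norm_le
  refine ⟨max r 1, lt_max_of_lt_right one_pos, differentiable_invPhi hg.continuous hgc,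
    fun n => ?_⟩
  obtain ⟨C, hC⟩ := norm_invPhi_le (r := max r 1) n hg hgc fun ξ hξ =>
    (hr ξ hξ).trans (le_max_left _ _)
  refine ⟨C, fun z => ?_⟩
  have h : 0 < (1 + ‖z‖) ^ n := by positivity
  rw [mul_right_comm, ← div_eq_mul_inv, le_div_iff₀ h, mul_comm]
  exact hC z

/-- The function `w ↦ √(2π) g(2πw)`, whose inverse Fourier transform in the normalization of
Mathlib is `invPhi g`. -/
noncomputable def rescale (g : ℝ → ℂ) (w : ℝ) : ℂ :=
  (Real.sqrt (2 * Real.pi) : ℂ) * g (2 * Real.pi * w)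

theorem contDiff_rescale {g : ℝ → ℂ} (hg : ContDiff ℝ ∞ g) : ContDiff ℝ ∞ (rescale g) :=
  contDiff_const.mul (hg.comp (contDiff_const.mul contDiff_id))

theorem hasCompactSupport_rescale {g : ℝ → ℂ} (hgc : HasCompactSupport g) :
    HasCompactSupport (rescale g) := by
  have h : (2 * Real.pi) ≠ 0 := by positivity
  exact (hgc.comp_homeomorph (Homeomorph.mulLeft₀ _ h)).mul_left

theorem invPhi_eq_fourierInv (g : ℝ → ℂ) (x : ℝ) : invPhi g x = 𝓕⁻ (rescale g) x := by
  rw [Real.fourierInv_eq', invPhi, phiConst_eq]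
  have h := Measure.integral_comp_mul_left
    (fun ξ : ℝ => g ξ * Complex.exp (Complex.I * x * ξ)) (2 * Real.pi)
  have hpos : (0 : ℝ) < (2 * Real.pi)⁻¹ := by positivity
  rw [abs_of_pos hpos, Complex.real_smul] at h
  rw [Complex.ofReal_mul, mul_assoc, ← h, ← integral_const_mul]
  congr 1
  ext w
  simp only [rescale, smul_eq_mul, RCLike.inner_apply, conj_trivial]
  push_cast
  rw [show Complex.I * (x : ℂ) * (2 * Real.pi * w) = 2 * Real.pi * (x * w) * Complex.I by ring]
  ring

/-- The inverse Fourier transform of a test function, as an element of `𝒵`. -/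
noncomputable def invPhiZ (g : ℝ → ℂ) (hg : ContDiff ℝ ∞ g) (hgc : HasCompactSupport g) : ZSpace :=
  ⟨𝓕⁻ ((hasCompactSupport_rescale hgc).toSchwartzMap (contDiff_rescale hg)), invPhi g,
    fun x => by
      rw [invPhi_eq_fourierInv, SchwartzMap.fourierInv_coe]
      rfl, exists_hasTypeBound_invPhi hg hgc⟩

theorem invPhiZ_apply {g : ℝ → ℂ} (hg : ContDiff ℝ ∞ g) (hgc : HasCompactSupport g) (x : ℝ) :
    (invPhiZ g hg hgc : 𝓢(ℝ, ℂ)) x = invPhi g x := by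
  rw [invPhi_eq_fourierInv, invPhiZ, SchwartzMap.fourierInv_coe]
  rfl

theorem fourierPhi_invPhiZ {g : ℝ → ℂ} (hg : ContDiff ℝ ∞ g) (hgc : HasCompactSupport g) (ξ : ℝ) :
    fourierPhi (invPhiZ g hg hgc : 𝓢(ℝ, ℂ)) ξ = g ξ := by
  have hpi : (2 * Real.pi) ≠ 0 := by positivity
  set S := (hasCompactSupport_rescale hgc).toSchwartzMap (contDiff_rescale hg) with hS
  have h1 : 𝓕 (𝓕⁻ S) = S := FourierTransform.fourier_fourierInv_eq S
  have h2 : (𝓕 (𝓕⁻ S)) (ξ / (2 * Real.pi)) = (Real.sqrt (2 * Real.pi) : ℂ) * g ξ := by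
    rw [h1]
    change rescale g _ = _
    rw [rescale, mul_div_cancel₀ _ hpi]
  rw [SchwartzMap.fourier_coe, Real.fourier_real_eq_integral_exp_smul] at h2
  have h3 : ∫ x : ℝ, (invPhiZ g hg hgc : 𝓢(ℝ, ℂ)) x * Complex.exp (-(Complex.I * x * ξ)) =
      (Real.sqrt (2 * Real.pi) : ℂ) * g ξ := by
    rw [← h2]
    congr 1
    ext x
    rw [smul_eq_mul, mul_comm]
    congr 2
    have : (Real.pi : ℂ) ≠ 0 := by exact_mod_cast Real.pi_ne_zero
    push_cast
    field_simp
  have h4 : ((phiConst : ℝ) : ℂ) * (Real.sqrt (2 * Real.pi) : ℂ) = 1 := by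
    exact_mod_cast phiConst_mul_sqrt
  change ((phiConst : ℝ) : ℂ) * ∫ x : ℝ, _ = _
  rw [h3, ← mul_assoc, h4, one_mul]

/-! ### The change of variables `t = e^x` -/

theorem range_exp_univ : Real.exp '' Set.univ = Set.Ioi 0 := by
  rw [Set.image_univ, Real.range_exp]

theorem lintegral_Ioi_eq (F : ℝ → ℝ≥0∞) :
    ∫⁻ t in Set.Ioi (0 : ℝ), F t = ∫⁻ x : ℝ, ENNReal.ofReal (Real.exp x) * F (Real.exp x) := by
  rw [← range_exp_univ, lintegral_image_eq_lintegral_abs_deriv_mul MeasurableSet.univ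
    (fun x _ => (Real.hasDerivAt_exp x).hasDerivWithinAt) Real.exp_injective.injOn]
  simp

theorem integral_Ioi_eq (F : ℝ → ℂ) :
    ∫ t in Set.Ioi (0 : ℝ), F t = ∫ x : ℝ, (Real.exp x : ℂ) * F (Real.exp x) := by
  rw [← range_exp_univ, integral_image_eq_integral_abs_deriv_smul MeasurableSet.univ
    (fun x _ => (Real.hasDerivAt_exp x).hasDerivWithinAt) Real.exp_injective.injOn]
  simp

theorem Uinv_exp (φ : ℝ → ℂ) (x : ℝ) : Uinv φ (Real.exp x) = (Real.exp (-(x / 2)) : ℂ) * φ x := by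
  rw [Uinv, Real.log_exp, ← Real.exp_mul]
  push_cast
  congr 2
  ring

theorem memLp_Uinv {φ : ℝ → ℂ} (hc : Continuous φ) (hφ : MemLp φ 2) :
    MemLp (Uinv φ) 2 (volume.restrict (Set.Ioi (0 : ℝ))) := by
  refine ⟨?_, ?_⟩
  · have : Measurable (Uinv φ) := by
      unfold Uinv
      have := hc.measurable
      fun_prop
    exact this.aestronglyMeasurable
  · have h := hφ.2
    rw [eLpNorm_lt_top_iff_lintegral_rpow_enorm_lt_top (by norm_num) (by norm_num)] at h ⊢
    simp only [ENNReal.toReal_ofNat] at h ⊢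
    rw [lintegral_Ioi_eq]
    refine lt_of_eq_of_lt (lintegral_congr fun x => ?_) h
    rw [Uinv_exp, enorm_mul, ENNReal.mul_rpow_of_nonneg _ _ (by norm_num), ← mul_assoc]
    have : ENNReal.ofReal (Real.exp x) * ‖(Real.exp (-(x / 2)) : ℂ)‖ₑ ^ (2 : ℝ) = 1 := by
      rw [← ofReal_norm, Complex.norm_real, Real.norm_of_nonneg (Real.exp_pos _).le,
        ENNReal.ofReal_rpow_of_nonneg (Real.exp_pos _).le (by norm_num),
        ← ENNReal.ofReal_mul (Real.exp_pos _).le, ← Real.exp_mul, ← Real.exp_add]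
      ring_nf
      simp
    rw [this, one_mul]

/-! ### Density of the test functions -/

/-- The functions `f ∈ L²(ℝ₊)` for which `x ↦ e^{x/2} f(e^x)` is the inverse Fourier transform of
a test function. -/
noncomputable def testSpace : Submodule ℂ L2Plus where
  carrier := {f | ∃ g : ℝ → ℂ, ContDiff ℝ ∞ g ∧ HasCompactSupport g ∧
    f =ᵐ[volume.restrict (Set.Ioi (0 : ℝ))] Uinv fun x => invPhi g x}
  zero_mem' := by
    refine ⟨0, contDiff_const, HasCompactSupport.zero, ?_⟩
    filter_upwards [Lp.coeFn_zero ℂ 2 (volume.restrict (Set.Ioi (0 : ℝ)))] with t ht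
    change ((0 : L2Plus) : ℝ → ℂ) t = _
    rw [ht]
    simp [Uinv, invPhi]
  add_mem' := by
    rintro f₁ f₂ ⟨g₁, hg₁, hc₁, h₁⟩ ⟨g₂, hg₂, hc₂, h₂⟩
    refine ⟨g₁ + g₂, hg₁.add hg₂, hc₁.add hc₂, ?_⟩
    filter_upwards [Lp.coeFn_add f₁ f₂, h₁, h₂] with t h3 h4 h5
    rw [h3, Pi.add_apply, h4, h5, Uinv, Uinv, Uinv, ← mul_add, invPhi, invPhi, invPhi, ← mul_add,
      ← integral_add]
    · simp only [Pi.add_apply, add_mul]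
    · exact integrable_mul_of_hasCompactSupport hg₁.continuous hc₁ (by fun_prop)
    · exact integrable_mul_of_hasCompactSupport hg₂.continuous hc₂ (by fun_prop)
  smul_mem' := by
    rintro c f ⟨g, hg, hc, h⟩
    refine ⟨fun ξ => c * g ξ, contDiff_const.mul hg, hc.mul_left, ?_⟩
    filter_upwards [Lp.coeFn_smul c f, h] with t h1 h2
    rw [h1, Pi.smul_apply, h2, Uinv, Uinv, invPhi, invPhi]
    simp only [mul_assoc, integral_const_mul, smul_eq_mul]
    ring

theorem memLp_invPhi {g : ℝ → ℂ} (hg : ContDiff ℝ ∞ g) (hgc : HasCompactSupport g) :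
    MemLp (fun x : ℝ => invPhi g x) 2 := by
  simpa only [← invPhiZ_apply hg hgc] using (invPhiZ g hg hgc : 𝓢(ℝ, ℂ)).memLp 2

theorem continuous_invPhi {g : ℝ → ℂ} (hg : ContDiff ℝ ∞ g) (hgc : HasCompactSupport g) :
    Continuous fun x : ℝ => invPhi g x :=
  (differentiable_invPhi hg.continuous hgc).continuous.comp Complex.continuous_ofReal

theorem memLp_Uinv_invPhi {g : ℝ → ℂ} (hg : ContDiff ℝ ∞ g) (hgc : HasCompactSupport g) :
    MemLp (Uinv fun x => invPhi g x) 2 (volume.restrict (Set.Ioi (0 : ℝ))) :=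
  memLp_Uinv (continuous_invPhi hg hgc) (memLp_invPhi hg hgc)

theorem exists_rescale_eq {S : ℝ → ℂ} (hS : ContDiff ℝ ∞ S) (hSc : HasCompactSupport S) :
    ∃ g : ℝ → ℂ, ContDiff ℝ ∞ g ∧ HasCompactSupport g ∧ rescale g = S := by
  have hpi : (2 * Real.pi)⁻¹ ≠ 0 := by positivity
  refine ⟨fun ξ => (phiConst : ℂ) * S ((2 * Real.pi)⁻¹ * ξ),
    contDiff_const.mul (hS.comp (contDiff_const.mul contDiff_id)),
    (hSc.comp_homeomorph (Homeomorph.mulLeft₀ _ hpi)).mul_left, ?_⟩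
  ext w
  have h4 : (Real.sqrt (2 * Real.pi) : ℂ) * ((phiConst : ℝ) : ℂ) = 1 := by
    rw [mul_comm]
    exact_mod_cast phiConst_mul_sqrt
  rw [rescale, ← mul_assoc, h4, one_mul, inv_mul_cancel_left₀ (by positivity)]

/-- By Plancherel the hypothesis says that `𝓕 κ` is orthogonal to all smooth compactly supported
functions, which are dense. -/
theorem eq_zero_of_forall_inner_invPhi {κ : Lp ℂ 2 (volume : Measure ℝ)}
    (h : ∀ g : ℝ → ℂ, ContDiff ℝ ∞ g → HasCompactSupport g →
      ∫ x, (starRingEnd ℂ) (κ x) * invPhi g x = 0) : κ = 0 := by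
  have h0 : 𝓕 κ = 0 := by
    refine Dense.eq_zero_of_inner_left ℂ
      (Lp.dense_hasCompactSupport_contDiff (μ := (volume : Measure ℝ)) (F := ℂ) (p := 2)
        (by norm_num)) ?_
    rintro v ⟨S, hvS, hSc, hS⟩
    obtain ⟨g, hg, hgc, rfl⟩ := exists_rescale_eq hS hSc
    have hv : v = (hSc.toSchwartzMap hS).toLp 2 :=
      Lp.ext (hvS.trans ((hSc.toSchwartzMap hS).coeFn_toLp 2 volume).symm)
    have h1 : v = 𝓕 (𝓕⁻ v) := (FourierTransform.fourier_fourierInv_eq v).symm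
    rw [h1, Lp.inner_fourier_eq, hv, SchwartzMap.toLp_fourierInv_eq, L2.inner_def, ← h g hg hgc]
    refine integral_congr_ae ?_
    filter_upwards [(𝓕⁻ (hSc.toSchwartzMap hS)).coeFn_toLp 2 volume] with x hx
    rw [hx, RCLike.inner_apply', ← invPhiZ_apply hg hgc]
    rfl
  rw [← norm_eq_zero, ← Lp.norm_fourier_eq, h0, norm_zero]

theorem eq_zero_of_forall_inner_testSpace {h : L2Plus}
    (hh : ∀ g : ℝ → ℂ, ContDiff ℝ ∞ g → HasCompactSupport g →
      ∫ t in Set.Ioi (0 : ℝ), (starRingEnd ℂ) (h t) * Uinv (fun x => invPhi g x) t = 0) :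
    h = 0 := by
  have hm := Lp.stronglyMeasurable h
  -- The image of `h` under the unitary substitution `t = e^x`, which reduces the claim to `L²(ℝ)`.
  let q : ℝ → ℂ := fun x => (Real.exp (x / 2) : ℂ) * h (Real.exp x)
  have hqm : StronglyMeasurable q := by
    refine StronglyMeasurable.mul ?_ (hm.comp_measurable Real.measurable_exp)
    exact (by fun_prop : Continuous fun x : ℝ => (Real.exp (x / 2) : ℂ)).stronglyMeasurable
  have hInt : ∫⁻ x, ‖q x‖ₑ ^ (2 : ℝ) = ∫⁻ t in Set.Ioi (0 : ℝ), ‖h t‖ₑ ^ (2 : ℝ) := by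
    rw [lintegral_Ioi_eq]
    refine lintegral_congr fun x => ?_
    simp only [q]
    rw [enorm_mul, ENNReal.mul_rpow_of_nonneg _ _ (by norm_num)]
    congr 1
    rw [← ofReal_norm, Complex.norm_real, Real.norm_of_nonneg (Real.exp_pos _).le,
      ENNReal.ofReal_rpow_of_nonneg (Real.exp_pos _).le (by norm_num), ← Real.exp_mul]
    ring_nf
  have hq : MemLp q 2 := by
    refine ⟨hqm.aestronglyMeasurable, ?_⟩
    have h2 := (Lp.memLp h).2
    rw [eLpNorm_lt_top_iff_lintegral_rpow_enorm_lt_top (by norm_num) (by norm_num)] at h2 ⊢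
    simp only [ENNReal.toReal_ofNat] at h2 ⊢
    rwa [hInt]
  have h0 : hq.toLp q = 0 := by
    refine eq_zero_of_forall_inner_invPhi fun g hg hgc => ?_
    rw [← hh g hg hgc, integral_Ioi_eq]
    refine integral_congr_ae ?_
    filter_upwards [hq.coeFn_toLp] with x hx
    rw [hx, Uinv_exp]
    simp only [q, map_mul, Complex.conj_ofReal]
    have : (Real.exp x : ℂ) * (Real.exp (-(x / 2)) : ℂ) = (Real.exp (x / 2) : ℂ) := by
      rw [← Complex.ofReal_mul, ← Real.exp_add]
      ring_nf
    rw [← this]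
    ring
  have hq0 : ∫⁻ x, ‖q x‖ₑ ^ (2 : ℝ) = 0 := by
    rw [lintegral_eq_zero_iff (by fun_prop)]
    have h3 := hq.coeFn_toLp
    rw [h0] at h3
    filter_upwards [h3, Lp.coeFn_zero ℂ 2 (volume : Measure ℝ)] with x h4 h5
    rw [← h4, h5]
    simp
  rw [hInt, lintegral_eq_zero_iff (by fun_prop)] at hq0
  refine Lp.ext ?_
  filter_upwards [hq0, Lp.coeFn_zero ℂ 2 (volume.restrict (Set.Ioi (0 : ℝ)))] with t h4 h5
  rw [h5]
  simpa using h4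

theorem dense_testSpace : Dense (testSpace : Set L2Plus) := by
  rw [Submodule.dense_iff_topologicalClosure_eq_top, Submodule.topologicalClosure_eq_top_iff,
    Submodule.eq_bot_iff]
  intro h hh
  refine eq_zero_of_forall_inner_testSpace fun g hg hgc => ?_
  have hmem : (memLp_Uinv_invPhi hg hgc).toLp _ ∈ testSpace :=
    ⟨g, hg, hgc, MemLp.coeFn_toLp _⟩
  have h1 := Submodule.inner_left_of_mem_orthogonal hmem hh
  rw [L2.inner_def] at h1
  rw [← h1]
  refine integral_congr_ae ?_
  filter_upwards [(memLp_Uinv_invPhi hg hgc).coeFn_toLp] with t ht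
  rw [ht, RCLike.inner_apply']

/-! ### Gamma factors -/

theorem contDiff_one_div_Gamma_line (a : ℂ) :
    ContDiff ℝ ∞ fun ξ : ℝ => (Complex.Gamma (a + Complex.I * ξ))⁻¹ := by
  have h1 : ContDiff ℝ ∞ fun s : ℂ => (Complex.Gamma s)⁻¹ :=
    (Complex.differentiable_one_div_Gamma.contDiff (n := ∞)).restrict_scalars ℝ
  have h2 : ContDiff ℝ ∞ fun ξ : ℝ => a + Complex.I * (ξ : ℂ) :=
    contDiff_const.add (contDiff_const.mul Complex.ofRealCLM.contDiff)
  exact h1.comp h2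

theorem Gamma_line_ne_zero {a : ℝ} (ha : 0 < a) (ξ : ℝ) :
    Complex.Gamma (a + Complex.I * ξ) ≠ 0 :=
  Complex.Gamma_ne_zero_of_re_pos (by simpa using ha)

theorem contDiff_Gamma_line {a : ℝ} (ha : 0 < a) :
    ContDiff ℝ ∞ fun ξ : ℝ => Complex.Gamma (a + Complex.I * ξ) := by
  have h := (contDiff_one_div_Gamma_line a).inv fun ξ => inv_ne_zero (Gamma_line_ne_zero ha ξ)
  rwa [show (fun ξ : ℝ => (Complex.Gamma (a + Complex.I * ξ))⁻¹)⁻¹ =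
    fun ξ : ℝ => Complex.Gamma (a + Complex.I * ξ) from funext fun ξ => inv_inv _] at h

theorem conj_Gamma_line (a ξ : ℝ) : (starRingEnd ℂ) (Complex.Gamma (a + Complex.I * ξ)) =
    Complex.Gamma (a - Complex.I * ξ) := by
  rw [← Complex.Gamma_conj]
  simp [sub_eq_add_neg]

/-- The function `Γ(1/2 + iξ) g(ξ)`. -/
noncomputable def gammaMul (g : ℝ → ℂ) (ξ : ℝ) : ℂ :=
  Complex.Gamma ((1 / 2 : ℝ) + Complex.I * ξ) * g ξ

theorem contDiff_gammaMul {g : ℝ → ℂ} (hg : ContDiff ℝ ∞ g) : ContDiff ℝ ∞ (gammaMul g) :=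
  (contDiff_Gamma_line (by norm_num)).mul hg

theorem hasCompactSupport_gammaMul {g : ℝ → ℂ} (hg : HasCompactSupport g) :
    HasCompactSupport (gammaMul g) := hg.mul_left

/-- `Γ` has no zeros on the line and `1/Γ` is entire, so division preserves test functions.
Injectivity of the Laplace transform rests on this. -/
theorem exists_gammaMul_eq {h : ℝ → ℂ} (hh : ContDiff ℝ ∞ h) (hhc : HasCompactSupport h) :
    ∃ g, ContDiff ℝ ∞ g ∧ HasCompactSupport g ∧ gammaMul g = h := by
  refine ⟨fun ξ => (Complex.Gamma ((1 / 2 : ℝ) + Complex.I * ξ))⁻¹ * h ξ,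
    (contDiff_one_div_Gamma_line _).mul hh, hhc.mul_left, ?_⟩
  ext ξ
  rw [gammaMul, mul_inv_cancel_left₀ (Gamma_line_ne_zero (by norm_num) ξ)]

theorem cpow_add_I_mul {s : ℝ} (hs : 0 < s) (r ξ : ℝ) :
    (s : ℂ) ^ ((r : ℂ) + Complex.I * ξ) =
      ((s ^ r : ℝ) : ℂ) * Complex.exp (Complex.I * Real.log s * ξ) := by
  rw [Complex.cpow_add _ _ (by exact_mod_cast hs.ne'), Complex.ofReal_cpow hs.le,
    Complex.cpow_def_of_ne_zero (by exact_mod_cast hs.ne') (Complex.I * ξ),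
    Complex.ofReal_log hs.le]
  congr 2
  ring

theorem norm_exp_I_mul_ofReal_mul (x ξ : ℝ) : ‖Complex.exp (Complex.I * x * ξ)‖ = 1 := by
  simp [norm_exp_I_mul]

/-! ### The Laplace transform of test functions -/

theorem integrable_laplace_test {g : ℝ → ℂ} (hg : Continuous g) (hgc : HasCompactSupport g)
    {t : ℝ} (ht : 0 < t) :
    Integrable (Function.uncurry fun (s ξ : ℝ) =>
      (((s ^ (-(1 / 2) : ℝ) * Real.exp (-(t * s)) : ℝ)) : ℂ) *
        (g ξ * Complex.exp (Complex.I * Real.log s * ξ)))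
      ((volume.restrict (Set.Ioi (0 : ℝ))).prod volume) := by
  have h1 : IntegrableOn (fun s : ℝ => s ^ (-(1 / 2) : ℝ) * Real.exp (-(t * s)))
      (Set.Ioi 0) := by
    have := integrableOn_rpow_mul_exp_neg_mul_rpow (s := (-(1 / 2) : ℝ)) (p := 1) (b := t)
      (by norm_num) one_pos ht
    simpa using this
  have h2 : Integrable g := hg.integrable_of_hasCompactSupport hgc
  refine Integrable.mono (h1.ofReal (𝕜 := ℂ) |>.mul_prod h2) ?_ (ae_of_all _ fun p => ?_)
  · have := hg.measurable
    refine Measurable.aestronglyMeasurable ?_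
    unfold Function.uncurry
    fun_prop
  · simp only [Function.uncurry, norm_mul, norm_exp_I_mul_ofReal_mul, mul_one]
    rfl

/-- A Mellin computation: `s^{-1/2+iξ}` has Laplace transform `Γ(1/2+iξ) t^{-1/2-iξ}`. The sign
change of `ξ` in the exponent appears as the reflection of `log t`. -/
theorem laplaceFun_Uinv_invPhi {g : ℝ → ℂ} (hg : Continuous g) (hgc : HasCompactSupport g)
    {t : ℝ} (ht : 0 < t) :
    laplaceFun (Uinv fun x => invPhi g x) t =
      ((t ^ (-(1 / 2) : ℝ) : ℝ) : ℂ) * invPhi (gammaMul g) ((-Real.log t : ℝ) : ℂ) := by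
  have h1 : ∀ s ∈ Set.Ioi (0 : ℝ),
      Complex.exp (-(t * s : ℝ)) * Uinv (fun x => invPhi g x) s =
      (phiConst : ℂ) * ∫ ξ : ℝ, (((s ^ (-(1 / 2) : ℝ) * Real.exp (-(t * s)) : ℝ)) : ℂ) *
        (g ξ * Complex.exp (Complex.I * Real.log s * ξ)) := fun s _ => by
    rw [Uinv, invPhi, integral_const_mul]
    push_cast
    ring
  rw [laplaceFun, setIntegral_congr_fun measurableSet_Ioi h1, integral_const_mul,
    integral_integral_swap (integrable_laplace_test hg hgc ht), invPhi, mul_left_comm]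
  congr 1
  rw [← integral_const_mul]
  refine integral_congr_ae (ae_of_all _ fun ξ => ?_)
  have h2 := Complex.integral_cpow_mul_exp_neg_mul_Ioi
    (a := ((1 / 2 : ℝ) : ℂ) + Complex.I * ξ) (r := t) (by simp) ht
  have h3 : (1 / (t : ℂ)) ^ (((1 / 2 : ℝ) : ℂ) + Complex.I * ξ) =
      ((t ^ (-(1 / 2) : ℝ) : ℝ) : ℂ) * Complex.exp (Complex.I * ((-Real.log t : ℝ) : ℂ) * ξ) := by
    have h4 : (1 / (t : ℂ)) = ((t⁻¹ : ℝ) : ℂ) := by push_cast; rw [one_div]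
    rw [h4, cpow_add_I_mul (inv_pos.2 ht), Real.log_inv, Real.inv_rpow ht.le, Real.rpow_neg ht.le]
  rw [h3] at h2
  have h5 : ∀ s ∈ Set.Ioi (0 : ℝ),
      (((s ^ (-(1 / 2) : ℝ) * Real.exp (-(t * s)) : ℝ)) : ℂ) *
        (g ξ * Complex.exp (Complex.I * Real.log s * ξ)) =
      g ξ * ((s : ℂ) ^ (((1 / 2 : ℝ) : ℂ) + Complex.I * ξ - 1) * Complex.exp (-(t * s))) :=
    fun s hs => by
      have h6 : ((1 / 2 : ℝ) : ℂ) + Complex.I * ξ - 1 =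
          ((-(1 / 2) : ℝ) : ℂ) + Complex.I * ξ := by push_cast; ring
      rw [h6, cpow_add_I_mul hs]
      push_cast
      ring
  beta_reduce
  rw [setIntegral_congr_fun measurableSet_Ioi h5, integral_const_mul, h2, gammaMul]
  ring

theorem laplace_test {g : ℝ → ℂ} (hg : ContDiff ℝ ∞ g) (hgc : HasCompactSupport g) {f : L2Plus}
    (hf : f =ᵐ[volume.restrict (Set.Ioi (0 : ℝ))] Uinv fun x => invPhi g x) :
    laplace f =ᵐ[volume.restrict (Set.Ioi (0 : ℝ))]
      Uinv fun x => invPhi (gammaMul g) ((-x : ℝ) : ℂ) := by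
  filter_upwards [coeFn_laplace f, ae_restrict_mem measurableSet_Ioi] with t h1 ht
  have h2 : laplaceFun f t = laplaceFun (Uinv fun x => invPhi g x) t := by
    refine integral_congr_ae ?_
    filter_upwards [hf] with s hs
    rw [hs]
  rw [h1, h2, laplaceFun_Uinv_invPhi hg.continuous hgc ht, Uinv]

theorem invPhi_comp_neg (g : ℝ → ℂ) (z : ℂ) : invPhi (fun ξ => g (-ξ)) z = invPhi g (-z) := by
  rw [invPhi, invPhi, ← integral_neg_eq_self]
  simp

/-- By self-adjointness a vector of the kernel is orthogonal to the range, which contains every test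
function: apply the transform to `g(-ξ)` divided by the Gamma factor, the sign undoing the
reflection. -/
theorem laplace_injective : Function.Injective laplace := by
  rw [injective_iff_map_eq_zero]
  intro h hh
  refine eq_zero_of_forall_inner_testSpace fun g hg hgc => ?_
  obtain ⟨q, hq, hqc, hqg⟩ := exists_gammaMul_eq (h := fun ξ => g (-ξ)) (hg.comp contDiff_neg)
    (hgc.comp_homeomorph (Homeomorph.neg ℝ))
  let f : L2Plus := (memLp_Uinv_invPhi hq hqc).toLp _
  have h1 := laplace_test hq hqc (f := f) (MemLp.coeFn_toLp _)
  have h2 : ⟪h, laplace f⟫_ℂ = 0 := by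
    rw [← isSelfAdjoint_laplace.isSymmetric.apply_clm, hh, inner_zero_left]
  rw [L2.inner_def] at h2
  rw [← h2]
  refine integral_congr_ae ?_
  filter_upwards [h1] with t ht
  rw [ht, RCLike.inner_apply', hqg]
  simp only [invPhi_comp_neg, Complex.ofReal_neg, neg_neg]

theorem norm_laplace_test_sq {g : ℝ → ℂ} (hg : ContDiff ℝ ∞ g) (hgc : HasCompactSupport g)
    {f : L2Plus} (hf : f =ᵐ[volume.restrict (Set.Ioi (0 : ℝ))] Uinv fun x => invPhi g x) :
    ‖laplace f‖ ^ 2 = ∫ x : ℝ, ‖invPhi (gammaMul g) x‖ ^ 2 := by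
  have h1 : ((‖laplace f‖ ^ 2 : ℝ) : ℂ) = ⟪laplace f, laplace f⟫_ℂ := by
    rw [inner_self_eq_norm_sq_to_K]
    norm_cast
  have h2 : ⟪laplace f, laplace f⟫_ℂ =
      ((∫ x : ℝ, ‖invPhi (gammaMul g) x‖ ^ 2 : ℝ) : ℂ) := by
    rw [← integral_neg_eq_self, ← integral_complex_ofReal, L2.inner_def]
    trans ∫ t in Set.Ioi (0 : ℝ), ((‖Uinv (fun x => invPhi (gammaMul g) ((-x : ℝ) : ℂ)) t‖ ^ 2 : ℝ)
      : ℂ)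
    · refine integral_congr_ae ?_
      filter_upwards [laplace_test hg hgc hf] with t ht
      rw [ht, RCLike.inner_apply', ← Complex.normSq_eq_conj_mul_self, Complex.normSq_eq_norm_sq]
    · rw [integral_Ioi_eq]
      congr 1
      ext x
      rw [Uinv_exp, norm_mul, Complex.norm_real, Real.norm_of_nonneg (Real.exp_pos _).le, mul_pow,
        ← Real.exp_nat_mul, ← Complex.ofReal_mul, ← mul_assoc, ← Real.exp_add]
      have : x + ((2 : ℕ) : ℝ) * -(x / 2) = 0 := by push_cast; ring
      rw [this, Real.exp_zero, one_mul]
  exact_mod_cast h1.trans h2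

/-! ### Autocorrelations and the Laplace convolution of test functions -/

/-- The autocorrelation `ξ ↦ ∫ conj(γ(η)) γ(η + ξ) dη`. -/
noncomputable def autocorr (γ : ℝ → ℂ) (ξ : ℝ) : ℂ :=
  ∫ η : ℝ, (starRingEnd ℂ) (γ η) * γ (η + ξ)

theorem autocorr_eq_convolution (γ : ℝ → ℂ) :
    autocorr γ = MeasureTheory.convolution (fun η => (starRingEnd ℂ) (γ (-η))) γ
      (ContinuousLinearMap.mul ℝ ℂ) volume := by
  ext ξ
  rw [autocorr, convolution_def, ← integral_neg_eq_self]
  refine integral_congr_ae (ae_of_all _ fun η => ?_)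
  simp only [ContinuousLinearMap.mul_apply']
  congr 2
  ring

theorem contDiff_autocorr {γ : ℝ → ℂ} (hγ : ContDiff ℝ ∞ γ) (hγc : HasCompactSupport γ) :
    ContDiff ℝ ∞ (autocorr γ) := by
  rw [autocorr_eq_convolution]
  have hc : Continuous fun η => (starRingEnd ℂ) (γ (-η)) :=
    Complex.continuous_conj.comp (hγ.continuous.comp continuous_neg)
  exact hγc.contDiff_convolution_right _ hc.locallyIntegrable hγ

theorem hasCompactSupport_autocorr {γ : ℝ → ℂ} (hγc : HasCompactSupport γ) :
    HasCompactSupport (autocorr γ) := by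
  rw [autocorr_eq_convolution]
  refine HasCompactSupport.convolution _ ?_ hγc
  exact (hγc.comp_homeomorph (Homeomorph.neg ℝ)).comp_left (g := starRingEnd ℂ) (map_zero _)

theorem hasCompactSupport_conj_mul {γ : ℝ → ℂ} (hγc : HasCompactSupport γ) :
    HasCompactSupport fun p : ℝ × ℝ => (starRingEnd ℂ) (γ p.1) * γ p.2 := by
  refine HasCompactSupport.intro (hγc.isCompact.prod hγc.isCompact) fun p hp => ?_
  rw [Set.mem_prod, not_and_or] at hp
  rcases hp with hp | hp
  · rw [image_eq_zero_of_notMem_tsupport hp, map_zero, zero_mul]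
  · rw [image_eq_zero_of_notMem_tsupport hp, mul_zero]

/-- The measure-preserving shear `(η, ξ) ↦ (η, η + ξ)` isolates the difference variable on which `m`
depends. -/
theorem integral_prod_eq_autocorr {γ m : ℝ → ℂ} (hγ : Continuous γ) (hγc : HasCompactSupport γ)
    (hm : Continuous m) :
    ∫ p : ℝ × ℝ, (starRingEnd ℂ) (γ p.1) * γ p.2 * m (p.2 - p.1) =
      ∫ ξ : ℝ, m ξ * autocorr γ ξ := by
  have hc : Continuous fun p : ℝ × ℝ => (starRingEnd ℂ) (γ p.1) * γ p.2 * m (p.2 - p.1) := by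
    fun_prop
  have hInt : Integrable fun p : ℝ × ℝ => (starRingEnd ℂ) (γ p.1) * γ p.2 * m (p.2 - p.1) :=
    hc.integrable_of_hasCompactSupport (hasCompactSupport_conj_mul hγc).mul_right
  have hmp := measurePreserving_prod_add (volume : Measure ℝ) (volume : Measure ℝ)
  have hemb : MeasurableEmbedding fun p : ℝ × ℝ => (p.1, p.1 + p.2) :=
    (MeasurableEquiv.shearAddRight ℝ).measurableEmbedding
  have h1 := hmp.integral_comp hemb
    fun p : ℝ × ℝ => (starRingEnd ℂ) (γ p.1) * γ p.2 * m (p.2 - p.1)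
  have h2 : Integrable (fun q : ℝ × ℝ => (starRingEnd ℂ) (γ q.1) * γ (q.1 + q.2) *
      m (q.1 + q.2 - q.1)) (volume.prod volume) := (hmp.integrable_comp_emb hemb).2 hInt
  simp only at h1
  rw [Measure.volume_eq_prod, ← h1, integral_prod_symm _ h2]
  refine integral_congr_ae (ae_of_all _ fun ξ => ?_)
  simp only [add_sub_cancel_left]
  rw [integral_mul_const, mul_comm, autocorr]

theorem conj_invPhi_mul_invPhi {γ : ℝ → ℂ} (hγ : Continuous γ) (hγc : HasCompactSupport γ)
    (x : ℝ) : (starRingEnd ℂ) (invPhi γ x) * invPhi γ x =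
      invPhi (fun ξ => (phiConst : ℂ) * autocorr γ ξ) x := by
  have h1 := integral_prod_eq_autocorr hγ hγc
    (m := fun ξ : ℝ => Complex.exp (Complex.I * x * ξ)) (by fun_prop)
  have h2 : (starRingEnd ℂ) (∫ ξ : ℝ, γ ξ * Complex.exp (Complex.I * x * ξ)) *
      (∫ ξ : ℝ, γ ξ * Complex.exp (Complex.I * x * ξ)) =
      ∫ ξ : ℝ, Complex.exp (Complex.I * x * ξ) * autocorr γ ξ := by
    rw [← h1, ← integral_conj, Measure.volume_eq_prod, ← integral_prod_mul]
    refine integral_congr_ae (ae_of_all _ fun p => ?_)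
    simp only [map_mul, ← Complex.exp_conj, Complex.conj_I, Complex.conj_ofReal]
    have h3 : Complex.exp (Complex.I * x * ((p.2 - p.1 : ℝ) : ℂ)) =
        Complex.exp (-Complex.I * x * p.1) * Complex.exp (Complex.I * x * p.2) := by
      rw [← Complex.exp_add]
      push_cast
      ring_nf
    rw [h3]
    ring
  simp only [invPhi, map_mul, Complex.conj_ofReal, mul_assoc, integral_const_mul] at h2 ⊢
  rw [mul_left_comm _ (phiConst : ℂ), h2]
  simp only [mul_comm]

theorem integrableOn_rpow_neg_half_mul_rpow {T : ℝ} (hT : 0 < T) :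
    IntegrableOn (fun s : ℝ => s ^ (-(1 / 2) : ℝ) * (T - s) ^ (-(1 / 2) : ℝ)) (Set.Ioo 0 T) := by
  have h1 := (Complex.betaIntegral_convergent (u := 1 / 2) (v := 1 / 2) (by norm_num)
    (by norm_num)).comp_mul_left (c := T⁻¹)
  have h2 : (1 : ℝ) / T⁻¹ = T := by field_simp
  rw [zero_div, h2, intervalIntegrable_iff_integrableOn_Ioo_of_le hT.le] at h1
  have h3 := (h1.norm).const_mul T⁻¹
  refine IntegrableOn.congr_fun h3 (fun s hs => ?_) measurableSet_Ioo
  have hs0 : 0 < s := hs.1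
  have hs1 : 0 < T - s := sub_pos.2 hs.2
  have h4 : (1 : ℂ) - ((T⁻¹ * s : ℝ) : ℂ) = ((T⁻¹ * (T - s) : ℝ) : ℂ) := by
    push_cast
    have : (T : ℂ) ≠ 0 := by exact_mod_cast hT.ne'
    field_simp
  rw [h4, norm_mul, Complex.norm_cpow_eq_rpow_re_of_pos (by positivity),
    Complex.norm_cpow_eq_rpow_re_of_pos (by positivity)]
  have h5 : ((1 / 2 : ℂ) - 1).re = -(1 / 2 : ℝ) := by norm_num
  rw [h5, Real.mul_rpow (by positivity) hs0.le, Real.mul_rpow (by positivity) hs1.le]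
  have h6 : T⁻¹ * (T⁻¹ ^ (-(1 / 2) : ℝ) * T⁻¹ ^ (-(1 / 2) : ℝ)) = 1 := by
    have h7 : -(1 / 2 : ℝ) + -(1 / 2) = -1 := by norm_num
    rw [← Real.rpow_add (by positivity), h7, Real.rpow_neg_one, mul_inv_cancel₀ (by positivity)]
  calc _ = (T⁻¹ * (T⁻¹ ^ (-(1 / 2) : ℝ) * T⁻¹ ^ (-(1 / 2) : ℝ))) *
        (s ^ (-(1 / 2) : ℝ) * (T - s) ^ (-(1 / 2) : ℝ)) := by ring
    _ = _ := by rw [h6, one_mul]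

/-- A scaled Beta integral with parameters `1/2 - iη` and `1/2 + iζ`. Their sum `1 + i(ζ - η)` is
the source of the factor `Γ(1 + iξ)⁻¹` that the sign-function removes. -/
theorem integral_rpow_exp_eq_beta {T : ℝ} (hT : 0 < T) (η ζ : ℝ) :
    ∫ s in Set.Ioo 0 T, ((s ^ (-(1 / 2) : ℝ) * (T - s) ^ (-(1 / 2) : ℝ) : ℝ) : ℂ) *
      (Complex.exp (-(Complex.I * Real.log s * η)) *
        Complex.exp (Complex.I * Real.log (T - s) * ζ)) =
      Complex.exp (Complex.I * Real.log T * ((ζ - η : ℝ) : ℂ)) *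
        ((Complex.Gamma (1 + Complex.I * ((ζ - η : ℝ) : ℂ)))⁻¹ *
          ((starRingEnd ℂ) (Complex.Gamma ((1 / 2 : ℝ) + Complex.I * η)) *
            Complex.Gamma ((1 / 2 : ℝ) + Complex.I * ζ))) := by
  set u : ℂ := (1 / 2 : ℝ) - Complex.I * η with hu
  set v : ℂ := (1 / 2 : ℝ) + Complex.I * ζ with hv
  have hu0 : 0 < u.re := by simp [hu]
  have hv0 : 0 < v.re := by simp [hv]
  have h1 := Complex.betaIntegral_scaled u v hT
  have h2 := Complex.Gamma_mul_Gamma_eq_betaIntegral hu0 hv0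
  have huv : u + v = 1 + Complex.I * ((ζ - η : ℝ) : ℂ) := by
    rw [hu, hv]; push_cast; ring
  have huv1 : u + v - 1 = ((0 : ℝ) : ℂ) + Complex.I * ((ζ - η : ℝ) : ℂ) := by
    rw [huv]; push_cast; ring
  have hne : Complex.Gamma (u + v) ≠ 0 := by
    rw [huv]
    simpa using Gamma_line_ne_zero one_pos (ζ - η)
  rw [huv1, cpow_add_I_mul hT, Real.rpow_zero, Complex.ofReal_one, one_mul] at h1
  rw [conj_Gamma_line, ← hu, ← huv, h2, inv_mul_cancel_left₀ hne, ← h1,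
    intervalIntegral.integral_of_le hT.le, integral_Ioc_eq_integral_Ioo]
  refine setIntegral_congr_fun measurableSet_Ioo fun s hs => ?_
  have hs1 : 0 < T - s := sub_pos.2 hs.2
  have hu1 : u - 1 = ((-(1 / 2) : ℝ) : ℂ) + Complex.I * ((-η : ℝ) : ℂ) := by
    rw [hu]; push_cast; ring
  have hv1 : v - 1 = ((-(1 / 2) : ℝ) : ℂ) + Complex.I * ζ := by
    rw [hv]; push_cast; ring
  rw [hu1, hv1, cpow_add_I_mul hs.1, ← Complex.ofReal_sub, cpow_add_I_mul hs1]
  push_cast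
  ring_nf

/-- After inserting the Fourier integrals and integrating in `s` first, the individual Gamma factors
join `g` to form `gammaMul g`, and the rest depends only on the frequency difference, whence the
autocorrelation. -/
theorem laplaceConv_test {g : ℝ → ℂ} (hg : Continuous g) (hgc : HasCompactSupport g) (x : ℝ)
    (hγ : Continuous (gammaMul g)) :
    laplaceConv (Uinv fun x => invPhi g x) (Uinv fun x => invPhi g x) (Real.exp x) =
      invPhi (fun ξ => (phiConst : ℂ) *
        ((Complex.Gamma (1 + Complex.I * ξ))⁻¹ * autocorr (gammaMul g) ξ)) x := by
  set T := Real.exp x with hTx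
  have hT : 0 < T := Real.exp_pos x
  have hlog : Real.log T = x := Real.log_exp x
  have h1 : ∀ s ∈ Set.Ioo 0 T,
      (starRingEnd ℂ) (Uinv (fun x => invPhi g x) s) * Uinv (fun x => invPhi g x) (T - s) =
      (phiConst : ℂ) * phiConst * ∫ p : ℝ × ℝ,
        ((s ^ (-(1 / 2) : ℝ) * (T - s) ^ (-(1 / 2) : ℝ) : ℝ) : ℂ) *
          ((starRingEnd ℂ) (g p.1) * g p.2 * (Complex.exp (-(Complex.I * Real.log s * p.1)) *
            Complex.exp (Complex.I * Real.log (T - s) * p.2))) := fun s hs => by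
    have h2 : ∫ p : ℝ × ℝ, (starRingEnd ℂ) (g p.1) * g p.2 *
        (Complex.exp (-(Complex.I * Real.log s * p.1)) *
            Complex.exp (Complex.I * Real.log (T - s) * p.2)) =
        (starRingEnd ℂ) (∫ ξ : ℝ, g ξ * Complex.exp (Complex.I * Real.log s * ξ)) *
          ∫ ξ : ℝ, g ξ * Complex.exp (Complex.I * Real.log (T - s) * ξ) := by
      rw [← integral_conj, Measure.volume_eq_prod, ← integral_prod_mul]
      refine integral_congr_ae (ae_of_all _ fun p => ?_)
      simp only [map_mul, ← Complex.exp_conj, Complex.conj_I, Complex.conj_ofReal, neg_mul]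
      ring
    rw [integral_const_mul, h2]
    simp only [Uinv, invPhi, map_mul, Complex.conj_ofReal]
    push_cast
    ring
  have hInt : Integrable (Function.uncurry fun (s : ℝ) (p : ℝ × ℝ) =>
      ((s ^ (-(1 / 2) : ℝ) * (T - s) ^ (-(1 / 2) : ℝ) : ℝ) : ℂ) *
          ((starRingEnd ℂ) (g p.1) * g p.2 * (Complex.exp (-(Complex.I * Real.log s * p.1)) *
            Complex.exp (Complex.I * Real.log (T - s) * p.2))))
      ((volume.restrict (Set.Ioo 0 T)).prod volume) := by
    have hc : Continuous fun p : ℝ × ℝ => (starRingEnd ℂ) (g p.1) * g p.2 := by fun_prop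
    have h2 : Integrable fun p : ℝ × ℝ => (starRingEnd ℂ) (g p.1) * g p.2 :=
      hc.integrable_of_hasCompactSupport (hasCompactSupport_conj_mul hgc)
    refine Integrable.mono ((integrableOn_rpow_neg_half_mul_rpow hT).ofReal (𝕜 := ℂ)
      |>.mul_prod h2) ?_ (ae_of_all _ fun q => ?_)
    · have hgm := hg.measurable
      have hgm' : Measurable fun ξ => (starRingEnd ℂ) (g ξ) :=
        (Complex.continuous_conj.comp hg).measurable
      refine Measurable.aestronglyMeasurable ?_
      unfold Function.uncurry
      fun_prop
    · have h3 : ‖Complex.exp (-(Complex.I * Real.log q.1 * q.2.1))‖ = 1 := by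
        have := norm_exp_I_mul_ofReal_mul (Real.log q.1) (-q.2.1)
        rwa [Complex.ofReal_neg, mul_neg] at this
      simp only [Function.uncurry, norm_mul, norm_exp_I_mul_ofReal_mul, h3, mul_one]
      rfl
  rw [laplaceConv, intervalIntegral.integral_of_le hT.le, integral_Ioc_eq_integral_Ioo,
    setIntegral_congr_fun measurableSet_Ioo h1, integral_const_mul, integral_integral_swap hInt]
  have hm : Continuous fun ξ : ℝ => Complex.exp (Complex.I * x * ξ) *
      (Complex.Gamma (1 + Complex.I * ξ))⁻¹ := by
    have := (contDiff_one_div_Gamma_line 1).continuous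
    fun_prop
  have h4 := integral_prod_eq_autocorr hγ (hasCompactSupport_gammaMul hgc) hm
  have h5 : ∫ p : ℝ × ℝ, ∫ s in Set.Ioo 0 T,
      ((s ^ (-(1 / 2) : ℝ) * (T - s) ^ (-(1 / 2) : ℝ) : ℝ) : ℂ) *
          ((starRingEnd ℂ) (g p.1) * g p.2 * (Complex.exp (-(Complex.I * Real.log s * p.1)) *
            Complex.exp (Complex.I * Real.log (T - s) * p.2))) =
      ∫ ξ : ℝ, Complex.exp (Complex.I * x * ξ) *
        (Complex.Gamma (1 + Complex.I * ξ))⁻¹ * autocorr (gammaMul g) ξ := by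
    rw [← h4]
    refine integral_congr_ae (ae_of_all _ fun p => ?_)
    simp only [mul_left_comm _ ((starRingEnd ℂ) (g p.1) * g p.2)]
    rw [integral_const_mul, integral_rpow_exp_eq_beta hT, hlog, gammaMul, gammaMul, map_mul]
    ring
  rw [h5, invPhi, mul_assoc, ← integral_const_mul]
  congr 2
  ext ξ
  ring

/-! ### Hankel operators with a bounded non-negative sign-function -/

/-- A smooth compactly supported function as an element of `C₀^∞(ℝ)`. -/
def toCcInfty (g : ℝ → ℂ) (hg : ContDiff ℝ ∞ g) (hgc : HasCompactSupport g) : CcInfty :=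
  ⟨g, hg, hgc, Set.subset_univ _⟩

/-- Functionals are antilinear, so the multiplier `Γ(1 - iξ)⁻¹` acts on test functions through its
conjugate `Γ(1 + iξ)⁻¹`; the powers of `2π` cancel. -/
theorem apply_invPhiZ_eq_sign {θ s : ZDual} (hs : IsSignFunctionOf θ s) {K : ℝ → ℂ}
    (hK : ContDiff ℝ ∞ K) (hKc : HasCompactSupport K) :
    θ.toFun (invPhiZ (fun ξ => (Complex.Gamma (1 + Complex.I * ξ))⁻¹ * K ξ)
      ((contDiff_one_div_Gamma_line 1).mul hK) hKc.mul_left) = s.toFun (invPhiZ K hK hKc) := by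
  obtain ⟨a, b, ha, hb, hsb⟩ := hs
  have hG : ContDiff ℝ ∞ fun ξ : ℝ => (Complex.Gamma (1 + Complex.I * ξ))⁻¹ * K ξ :=
    (contDiff_one_div_Gamma_line 1).mul hK
  have hGc : HasCompactSupport fun ξ : ℝ => (Complex.Gamma (1 + Complex.I * ξ))⁻¹ * K ξ :=
    hKc.mul_left
  have h1 := ha (invPhiZ _ hG hGc) (toCcInfty _ hG hGc) fun ξ => (fourierPhi_invPhiZ hG hGc ξ).symm
  have h2 := hsb (invPhiZ K hK hKc) (toCcInfty K hK hKc) fun ξ => (fourierPhi_invPhiZ hK hKc ξ).symm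
  have h3 := hb (toCcInfty K hK hKc) (toCcInfty _ hG hGc) fun ξ => by
    have h4 := conj_Gamma_line 1 (-ξ)
    simp only [Complex.ofReal_one, Complex.ofReal_neg, mul_neg, sub_neg_eq_add,
      ← sub_eq_add_neg] at h4
    rw [map_inv₀, h4]
    rfl
  have h4 : (Real.sqrt (2 * Real.pi) : ℂ) * (((2 * Real.pi) ^ (-(1 / 2) : ℝ) : ℝ) : ℂ) = 1 := by
    rw [mul_comm]
    exact_mod_cast phiConst_mul_sqrt
  rw [← h1, ← h2]
  change _ = (Real.sqrt (2 * Real.pi) : ℂ) * b (toCcInfty K hK hKc)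
  rw [h3, ← mul_assoc, h4, one_mul]

section Sign

variable {H : L2Plus →L[ℂ] L2Plus} {θ s : ZDual}

/-- `apply_invPhiZ_eq_sign` strips `Γ(1 + iξ)⁻¹` from the transform of `Ω`, leaving an
autocorrelation, whose inverse transform is a squared modulus. -/
theorem inner_test_eq (hH : IsHankelOperator H θ) (hs : IsSignFunctionOf θ s) {s₀ : ℝ → ℝ}
    (hs₀ : ∀ u : ZSpace,
      s.toFun u = ∫ x : ℝ, (s₀ x : ℂ) * (starRingEnd ℂ) ((u : 𝓢(ℝ, ℂ)) x))
    {g : ℝ → ℂ} (hg : ContDiff ℝ ∞ g) (hgc : HasCompactSupport g) {f : L2Plus}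
    (hf : f =ᵐ[volume.restrict (Set.Ioi (0 : ℝ))] Uinv fun x => invPhi g x) :
    ⟪f, H f⟫_ℂ = ((∫ x : ℝ, s₀ x * ‖invPhi (gammaMul g) x‖ ^ 2 : ℝ) : ℂ) := by
  have hγ := contDiff_gammaMul hg
  have hγc := hasCompactSupport_gammaMul hgc
  have hK : ContDiff ℝ ∞ fun ξ => (phiConst : ℂ) * autocorr (gammaMul g) ξ :=
    contDiff_const.mul (contDiff_autocorr hγ hγc)
  have hKc : HasCompactSupport fun ξ => (phiConst : ℂ) * autocorr (gammaMul g) ξ :=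
    (hasCompactSupport_autocorr hγc).mul_left
  have hφ : ((invPhiZ g hg hgc : 𝓢(ℝ, ℂ)) : ℝ → ℂ) = fun x : ℝ => invPhi g x :=
    funext (invPhiZ_apply hg hgc)
  have h1 := hH (invPhiZ g hg hgc) (invPhiZ g hg hgc) f f (by rwa [hφ]) (by rwa [hφ])
    (invPhiZ (fun ξ => (Complex.Gamma (1 + Complex.I * ξ))⁻¹ *
      ((phiConst : ℂ) * autocorr (gammaMul g) ξ))
      ((contDiff_one_div_Gamma_line 1).mul hK) hKc.mul_left) fun x => by
      rw [invPhiZ_apply, hφ, laplaceConv_test hg.continuous hgc x hγ.continuous]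
      simp only [mul_left_comm (phiConst : ℂ)]
  rw [h1, apply_invPhiZ_eq_sign hs hK hKc, hs₀, ← integral_complex_ofReal]
  refine integral_congr_ae (ae_of_all _ fun x => ?_)
  simp only [invPhiZ_apply, ← conj_invPhi_mul_invPhi hγ.continuous hγc,
    ← Complex.normSq_eq_conj_mul_self, Complex.conj_ofReal, Complex.normSq_eq_norm_sq]
  push_cast
  rfl

/-- On test functions this is `0 ≤ s₀ ≤ C` integrated against the density of `‖laplace f‖²`. The
three conditions are closed in `f`, so they pass to the closure. -/
theorem exists_form_bound (hH : IsHankelOperator H θ) (hs : IsSignFunctionOf θ s)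
    (hpos : IsBoundedPositive s) : ∃ C : ℝ, ∀ f : L2Plus,
      (⟪f, H f⟫_ℂ).im = 0 ∧ 0 ≤ (⟪f, H f⟫_ℂ).re ∧ (⟪f, H f⟫_ℂ).re ≤ C * ‖laplace f‖ ^ 2 := by
  obtain ⟨s₀, hm, h0, ⟨C, hC⟩, hs₀⟩ := hpos
  refine ⟨C, fun f => ?_⟩
  refine dense_testSpace.induction (P := fun f : L2Plus => (⟪f, H f⟫_ℂ).im = 0 ∧
    0 ≤ (⟪f, H f⟫_ℂ).re ∧ (⟪f, H f⟫_ℂ).re ≤ C * ‖laplace f‖ ^ 2) ?_ ?_ f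
  · rintro f ⟨g, hg, hgc, hf⟩
    have hγ := contDiff_gammaMul hg
    have hγc := hasCompactSupport_gammaMul hgc
    rw [inner_test_eq hH hs hs₀ hg hgc hf, Complex.ofReal_im, Complex.ofReal_re,
      norm_laplace_test_sq hg hgc hf]
    have hInt : Integrable fun x : ℝ => ‖invPhi (gammaMul g) x‖ ^ 2 :=
      (memLp_two_iff_integrable_sq_norm (memLp_invPhi hγ hγc).1).1 (memLp_invPhi hγ hγc)
    refine ⟨rfl, integral_nonneg_of_ae ?_, ?_⟩
    · filter_upwards [h0] with x hx
      exact mul_nonneg hx (by positivity)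
    · rw [← integral_const_mul]
      refine integral_mono_of_nonneg ?_ (hInt.const_mul C) ?_
      · filter_upwards [h0] with x hx
        exact mul_nonneg hx (by positivity)
      · filter_upwards [hC] with x hx
        exact mul_le_mul_of_nonneg_right hx (by positivity)
  · have hc : Continuous fun f : L2Plus => ⟪f, H f⟫_ℂ := by fun_prop
    have hre := Complex.continuous_re.comp hc
    have him := Complex.continuous_im.comp hc
    refine (isClosed_eq him continuous_const).inter
      ((isClosed_le continuous_const hre).inter (isClosed_le hre ?_))
    fun_prop

theorem isSelfAdjoint_of_im_inner_eq_zero (h : ∀ f : L2Plus, (⟪f, H f⟫_ℂ).im = 0) :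
    IsSelfAdjoint H := by
  rw [ContinuousLinearMap.isSelfAdjoint_iff_isSymmetric,
    LinearMap.isSymmetric_iff_inner_map_self_real]
  intro f
  rw [inner_conj_symm]
  refine (Complex.conj_eq_iff_im.2 (h f)).symm.trans ?_
  rw [inner_conj_symm]
  rfl

end Sign

end HankelSign

/-! ### The perturbation theorem -/

open HankelSign in
theorem theorem3
    (H₀ V : L2Plus →L[ℂ] L2Plus)
    (θ₀ s₀ : ZDual)
    (hH₀ : IsHankelOperator H₀ θ₀)
    (hs₀ : IsSignFunctionOf θ₀ s₀)
    (hpos : IsBoundedPositive s₀)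
    (k : FiniteRankKernel)
    (hV : IsHankelIntegralOperator V k.kernel) :
    IsSelfAdjoint V ∧ IsSelfAdjoint (H₀ + V) ∧
      Nminus (H₀ + V) = (k.totalNeg : ℕ∞) ∧
      Nminus (H₀ + V) = Nminus V ∧
      ((H₀ + V).IsPositive ↔ V.IsPositive) := by
  obtain ⟨C, hC⟩ := exists_form_bound hH₀ hs₀ hpos
  have hH : IsSelfAdjoint H₀ := isSelfAdjoint_of_im_inner_eq_zero fun f => (hC f).1
  have hVsa := k.isSelfAdjoint hV
  have hN := k.Nminus_eq hV
  have heq : Nminus (H₀ + V) = k.totalNeg := by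
    -- The upper bound uses only `H₀ ≥ 0`. The lower one uses domination of `H₀` by the Laplace
    -- transform, whose range, equal to that of its adjoint, avoids the exponential polynomials.
    refine le_antisymm (k.Nminus_add_le hV hH fun f => (hC f).2.1) ?_
    rw [← hN]
    refine Nminus_le_Nminus_add hH hVsa laplace (fun f => (hC f).2.2) k.rangeSpan
      (k.apply_mem_rangeSpan hV) fun g hg => ?_
    have hadj : ContinuousLinearMap.adjoint laplace = laplace :=
      ContinuousLinearMap.isSelfAdjoint_iff'.1 isSelfAdjoint_laplace
    rw [hadj] at hg ⊢
    rw [k.eq_zero_of_laplace_mem laplace_injective hg, map_zero]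
  refine ⟨hVsa, hH.add hVsa, heq, heq.trans hN.symm, ?_⟩
  rw [isPositive_iff_Nminus_eq_zero (hH.add hVsa), isPositive_iff_Nminus_eq_zero hVsa, heq, hN]
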